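/- **Setting.** Let $\Bbbk$ be an algebraically closed field of characteristic $0$ and $q\in\Bbbk^\times$ with $q^2\neq 1$. Put $[r]=\frac{q^r-q^{-r}}{q-q^{-1}}$, and let $\mathbf{char}(q)$ be the least $r>0$ with $[r]=0$, or $0$ if there is none. Let $m,n\ge 0$, $I=\{1,\dots,m+n\}$, $J=\{1,\dots,m+n-1\}$; $i\in I$ is even if $i\le m$ and odd if $i>m$; $q_i=q$ for $i$ even and $q_i=q^{-1}$ for $i$ odd; $p(j)=1$ if $j=m$, and $p(j)=0$ for the other $j\in J$. *The algebras.* $\mathcal U_q(\mathfrak{gl}(m|n))$ is the associative unital $\Bbbk$-algebra with generators $E_j,F_j$ $(j\in J)$, $K_i^{\pm1}$ $(i\in I)$, $\sigma$ and relations - $K_iK_j=K_jK_i$, $K_iK_i^{-1}=K_i^{-1}K_i=1$; - $K_iE_j=q_i^{\delta_{i,j}-\delta_{i,j+1}}E_jK_i$, $K_iF_j=q_i^{-(\delta_{i,j}-\delta_{i,j+1})}F_jK_i$; - $E_iF_j-(-1)^{p(i)p(j)}F_jE_i=\delta_{ij}\,\frac{\mathcal K_i-\mathcal K_i^{-1}}{q_i-q_i^{-1}}$,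 where $\mathcal K_i=K_iK_{i+1}^{-1}$; - $E_iE_j=E_jE_i$ and $F_iF_j=F_jF_i$ for $|i-j|>1$; - $E_i^2E_j-(q+q^{-1})E_iE_jE_i+E_jE_i^2=0$ and $F_i^2F_j-(q+q^{-1})F_iF_jF_i+F_jF_i^2=0$ for $|i-j|=1$, $i\ne m$; - $E_m^2=F_m^2=0$, and $E_{m-1}E_mE_{m+1}E_m+E_mE_{m-1}E_mE_{m+1}+E_{m+1}E_mE_{m-1}E_m+E_mE_{m+1}E_mE_{m-1}-(q+q^{-1})E_mE_{m-1}E_{m+1}E_m=0$, together with the same relation for the $F$'s (whenever the indices occur); - $\sigma^2=1$, $\sigma E_j\sigma=(-1)^{p(j)}E_j$, $\sigma F_j\sigma=(-1)^{p(j)}F_j$, $\sigma K_i\sigma=K_i$. $\mathcal U_q(\mathfrak{sl}(m|n))$ is its subalgebra generated by all $E_j,F_j,\mathcal K_j^{\pm1}$ and $\sigma$. If $\mathbf{char}(q)=\ell>2$, then $u_q(\mathfrak{gl}(m|n))$, resp. $u_q(\mathfrak{sl}(m|n))$, is the quotient of $\mathcal U_q(\mathfrak{gl}(m|n))$, resp.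 $\mathcal U_q(\mathfrak{sl}(m|n))$, by the relations $E_j^\ell=F_j^\ell=0$ $(j\neq m)$, $E_m^2=F_m^2=0$ and $K_i^{2\ell}=1$, resp. $\mathcal K_j^{2\ell}=1$. Write $\mathcal U_q$ for $\mathcal U_q(\mathfrak{gl}(m|n))$ or $\mathcal U_q(\mathfrak{sl}(m|n))$, and $u_q$ for $u_q(\mathfrak{gl}(m|n))$ or $u_q(\mathfrak{sl}(m|n))$. *The module.* The quantum dual Grassmann superalgebra $\Omega_q^!(m|n)=\Lambda_q(m)\otimes\mathcal A_{q^{-1}}(n)$ has the $\Bbbk$-basis of monomials $x^\beta=x^\mu\otimes x^{(\alpha)}$, where $\beta=\langle\mu,\alpha\rangle\in\{0,1\}^m\times\mathbb Z_{\ge0}^n$. Set $x^\beta=0$ for every other $\beta\in\mathbb Z^{m+n}$. Let $\epsilon_i$ be the $i$-th unit vector, and put $c_j(\beta)=\prod_{s<j,\ s\le m}(-q)^{\beta_s}\prod_{m<s<j}q^{\beta_s}$. Define operators by $$x_j.x^\beta=c_j(\beta)^{-1}b_j(\beta)\,x^{\beta+\epsilon_j},\qquad \partial_j.x^\beta=c_j(\beta)\,x^{\beta-\epsilon_j},\qquad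 \sigma_j.x^\beta=q_j^{\beta_j}x^\beta,$$ with $b_j(\beta)=1$ for $j\le m$ and $b_j(\beta)=[\beta_j+1]$ for $j>m$. Then $\Omega_q^!(m|n)$ is a $\mathcal U_q$-module by $$E_j=x_j\partial_{j+1}\sigma_j,\quad F_j=\sigma_j^{-1}x_{j+1}\partial_j,\quad K_i=\sigma_i,\quad \sigma.(x^\mu\otimes x^{(\alpha)})=(-1)^{|\alpha|}x^\mu\otimes x^{(\alpha)}.$$ If $\mathbf{char}(q)=\ell>2$, the span $\Omega_q^!(m|n,\mathbf 1)$ of the monomials with all $\alpha_i\le\ell-1$ is stable, and this action makes it a $u_q$-module. For $t\ge0$, the homogeneous component of degree $t$ of either space, denoted by the superscript $(t)$, is the span of its monomials with $|\mu|+|\alpha|=t$. *The modules $V(\lambda)$.* Let $A$ be $\mathcal U_q$ or $u_q$ and $\lambda=\sum_i\lambda_i\epsilon_i$ with $\lambda_i\in\mathbb Z$. A vector of weight $\lambda$ is one on which $K_i$ acts by $q_i^{\lambda_i}$ (in the $\mathfrak{gl}$ case), resp. $\mathcal K_j$ acts by $q_j^{\lambda_j}q_{j+1}^{-\lambda_{j+1}}$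 (in the $\mathfrak{sl}$ case), and $\sigma$ acts by $(-1)^{\sum_{i>m}\lambda_i}$; it is a highest weight vector if it is nonzero and killed by all $E_j$. Let $M(\lambda)$ be the $A$-module generated by one vector subject exactly to the relations that it have weight $\lambda$ and be killed by all $E_j$. Then $V(\lambda)$ is the quotient of $M(\lambda)$ by its largest submodule contained in $\sum_jF_jM(\lambda)$. **Theorem.** For all $m,n,t\ge 0$, and in the $\mathfrak{gl}$ as well as in the $\mathfrak{sl}$ case, $\Omega_q^!(m|n)^{(t)}$ is a $\mathcal U_q$-submodule of $\Omega_q^!(m|n)$; and if $\mathbf{char}(q)=\ell>2$, then $\Omega_q^!(m|n,\mathbf 1)^{(t)}$ is a $u_q$-submodule of $\Omega_q^!(m|n,\mathbf 1)$. Put $\omega_r=\epsilon_1+\dots+\epsilon_r$. 1. Let $\mathbf{char}(q)=0$. If $t\le m$, then $\Omega_q^!(m|n)^{(t)}\cong V(\omega_t)$ is a simple module generated by the highest weight vector $x^{\omega_t}\otimes1$ of weight $\omega_t$. If $t>m$ and $n\ge1$, then $\Omega_q^!(m|n)^{(t)}\cong V(\omega_m+(t-m)\epsilon_{m+1})$ is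 a simple module generated by the highest weight vector $x^{\omega_m}\otimes x^{((t-m)\epsilon_{m+1})}$ of that weight. 2. Let $\mathbf{char}(q)=\ell>2$. If $t\le m$, then $\Omega_q^!(m|n,\mathbf 1)^{(t)}\cong V(\omega_t)$ is a simple $u_q$-module generated by the highest weight vector $x^{\omega_t}\otimes1$ of weight $\omega_t$. If $t>m$ and $t-m=(i-1)(\ell-1)+t_i$ with $1\le i\le n$ and $0\le t_i\le\ell-1$, then $$\Omega_q^!(m|n,\mathbf 1)^{(t)}\cong V\bigl(\omega_m+(\ell-1)\epsilon_{m+1}+\dots+(\ell-1)\epsilon_{m+i-1}+t_i\epsilon_{m+i}\bigr)$$ is a simple $u_q$-module generated by the highest weight vector $x^{\omega_m}\otimes x^{((\ell-1)\epsilon_{m+1}+\dots+(\ell-1)\epsilon_{m+i-1}+t_i\epsilon_{m+i})}$ of that weight. -/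

import Mathlib

noncomputable section

namespace QSuper

/-! ### The quantum superalgebra `U_q(gl(m|n))`, its bosonization, and the variants for `sl` and for
`q` a root of unity.  Indices are zero-based: `i : Fin (m + n)` is even when `i < m`, and
`j : Fin (m + n - 1)` numbers the simple root `ε_j - ε_{j+1}`, which is odd when `j + 1 = m`. -/

/-- The quantum integer `[r] = (q^r - q^{-r}) / (q - q^{-1})`. -/
def qnum {k : Type*} [Field k] (q : kˣ) (r : ℕ) : k :=
  ((q : k) ^ r - (q : k)⁻¹ ^ r) / ((q : k) - (q : k)⁻¹)

/-- The characteristic of `q`: the least `r > 0` with `[r] = 0`, and `0` if there is none. -/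
def charQ {k : Type*} [Field k] (q : kˣ) : ℕ := sInf {r : ℕ | 0 < r ∧ qnum q r = 0}

/-- `q_i = q` for even `i` and `q_i = q⁻¹` for odd `i`. -/
def qi {k : Type*} [Field k] (q : kˣ) {m n : ℕ} (i : Fin (m + n)) : kˣ := if (i : ℕ) < m then q else q⁻¹

/-- The position `j` of the simple root `ε_j - ε_{j+1}`. -/
def lo {m n : ℕ} (j : Fin (m + n - 1)) : Fin (m + n) := ⟨j, by omega⟩

/-- The position `j + 1` of the simple root `ε_j - ε_{j+1}`. -/
def hi {m n : ℕ} (j : Fin (m + n - 1)) : Fin (m + n) := ⟨j + 1, by omega⟩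

/-- The parity of `E_j` and `F_j`. -/
def par {m n : ℕ} (j : Fin (m + n - 1)) : ℕ := if (j : ℕ) + 1 = m then 1 else 0

/-- The generators `E_j`, `F_j`, `K_i`, `K_i⁻¹` and the parity element `σ`. -/
inductive Gen (m n : ℕ) : Type
  | E (j : Fin (m + n - 1))
  | F (j : Fin (m + n - 1))
  | K (i : Fin (m + n))
  | Kinv (i : Fin (m + n))
  | sigma

section relations

variable {k : Type*} [Field k] (q : kˣ) (m n : ℕ)

/-- `E_j` in the free algebra. -/
abbrev fE (j : Fin (m + n - 1)) : FreeAlgebra k (Gen m n) := FreeAlgebra.ι k (Gen.E j)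
/-- `F_j` in the free algebra. -/
abbrev fF (j : Fin (m + n - 1)) : FreeAlgebra k (Gen m n) := FreeAlgebra.ι k (Gen.F j)
/-- `K_i` in the free algebra. -/
abbrev fK (i : Fin (m + n)) : FreeAlgebra k (Gen m n) := FreeAlgebra.ι k (Gen.K i)
/-- `K_i⁻¹` in the free algebra. -/
abbrev fKinv (i : Fin (m + n)) : FreeAlgebra k (Gen m n) := FreeAlgebra.ι k (Gen.Kinv i)
/-- `σ` in the free algebra. -/
abbrev fS : FreeAlgebra k (Gen m n) := FreeAlgebra.ι k Gen.sigma

/-- The exponent `δ_{i,j} - δ_{i,j+1}`, the pairing of `K_i` with the root `ε_j - ε_{j+1}`. -/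
def pairing (i : Fin (m + n)) (j : Fin (m + n - 1)) : ℤ :=
  (if i = lo j then 1 else 0) - (if i = hi j then 1 else 0)

/-- The defining relations of `U_q(gl(m|n))`, together with those of its bosonization by the
parity element `σ`. -/
inductive Rel : FreeAlgebra k (Gen m n) → FreeAlgebra k (Gen m n) → Prop
  | KK (i j : Fin (m + n)) : Rel (fK m n i * fK m n j) (fK m n j * fK m n i)
  | KKinv (i : Fin (m + n)) : Rel (fK m n i * fKinv m n i) 1
  | KinvK (i : Fin (m + n)) : Rel (fKinv m n i * fK m n i) 1
  | KE (i : Fin (m + n)) (j : Fin (m + n - 1)) :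
      Rel (fK m n i * fE m n j) (((qi q i ^ pairing m n i j : kˣ) : k) • (fE m n j * fK m n i))
  | KF (i : Fin (m + n)) (j : Fin (m + n - 1)) :
      Rel (fK m n i * fF m n j) (((qi q i ^ (-pairing m n i j) : kˣ) : k) • (fF m n j * fK m n i))
  | EF_ne (i j : Fin (m + n - 1)) (h : i ≠ j) :
      Rel (fE m n i * fF m n j - (-1 : k) ^ (par i * par j) • (fF m n j * fE m n i)) 0
  | EF (i : Fin (m + n - 1)) :
      Rel (fE m n i * fF m n i - (-1 : k) ^ (par i * par i) • (fF m n i * fE m n i))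
        ((((qi q (lo i) : kˣ) : k) - ((qi q (lo i) : kˣ) : k)⁻¹)⁻¹ •
          (fK m n (lo i) * fKinv m n (hi i) - fK m n (hi i) * fKinv m n (lo i)))
  | EE (i j : Fin (m + n - 1)) (h : (i : ℕ) + 1 < j ∨ (j : ℕ) + 1 < i) :
      Rel (fE m n i * fE m n j) (fE m n j * fE m n i)
  | FF (i j : Fin (m + n - 1)) (h : (i : ℕ) + 1 < j ∨ (j : ℕ) + 1 < i) :
      Rel (fF m n i * fF m n j) (fF m n j * fF m n i)
  | serreE (i j : Fin (m + n - 1)) (h : (i : ℕ) + 1 = j ∨ (j : ℕ) + 1 = i) (hi : (i : ℕ) + 1 ≠ m) :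
      Rel (fE m n i * fE m n i * fE m n j
        - ((q : k) + (q : k)⁻¹) • (fE m n i * fE m n j * fE m n i)
        + fE m n j * fE m n i * fE m n i) 0
  | serreF (i j : Fin (m + n - 1)) (h : (i : ℕ) + 1 = j ∨ (j : ℕ) + 1 = i) (hi : (i : ℕ) + 1 ≠ m) :
      Rel (fF m n i * fF m n i * fF m n j
        - ((q : k) + (q : k)⁻¹) • (fF m n i * fF m n j * fF m n i)
        + fF m n j * fF m n i * fF m n i) 0
  | sqE (i : Fin (m + n - 1)) (hi : (i : ℕ) + 1 = m) : Rel (fE m n i * fE m n i) 0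
  | sqF (i : Fin (m + n - 1)) (hi : (i : ℕ) + 1 = m) : Rel (fF m n i * fF m n i) 0
  | superE (a b c : Fin (m + n - 1)) (hab : (a : ℕ) + 1 = b) (hb : (b : ℕ) + 1 = m)
      (hbc : (b : ℕ) + 1 = c) :
      Rel (fE m n a * fE m n b * fE m n c * fE m n b + fE m n b * fE m n a * fE m n b * fE m n c
        + fE m n c * fE m n b * fE m n a * fE m n b + fE m n b * fE m n c * fE m n b * fE m n a
        - ((q : k) + (q : k)⁻¹) • (fE m n b * fE m n a * fE m n c * fE m n b)) 0
  | superF (a b c : Fin (m + n - 1)) (hab : (a : ℕ) + 1 = b) (hb : (b : ℕ) + 1 = m)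
      (hbc : (b : ℕ) + 1 = c) :
      Rel (fF m n a * fF m n b * fF m n c * fF m n b + fF m n b * fF m n a * fF m n b * fF m n c
        + fF m n c * fF m n b * fF m n a * fF m n b + fF m n b * fF m n c * fF m n b * fF m n a
        - ((q : k) + (q : k)⁻¹) • (fF m n b * fF m n a * fF m n c * fF m n b)) 0
  | sigma_sq : Rel (fS m n * fS m n) 1
  | sigmaE (j : Fin (m + n - 1)) :
      Rel (fS m n * fE m n j * fS m n) ((-1 : k) ^ par j • fE m n j)
  | sigmaF (j : Fin (m + n - 1)) :
      Rel (fS m n * fF m n j * fS m n) ((-1 : k) ^ par j • fF m n j)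
  | sigmaK (i : Fin (m + n)) : Rel (fS m n * fK m n i * fS m n) (fK m n i)

/-- The Hopf algebra `𝒰_q(gl(m|n)) = U_q(gl(m|n)) # k[ℤ₂]` (as an algebra). -/
abbrev Uqgl : Type _ := RingQuot (Rel q m n)

/-- The class in `𝒰_q(gl(m|n))` of a generator. -/
def gen (g : Gen m n) : Uqgl q m n := RingQuot.mkAlgHom k (Rel q m n) (FreeAlgebra.ι k g)

/-- The elements `𝒦_j = K_j K_{j+1}⁻¹`. -/
def calK (j : Fin (m + n - 1)) : Uqgl q m n := gen q m n (.K (lo j)) * gen q m n (.Kinv (hi j))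

/-- The elements `𝒦_j⁻¹ = K_{j+1} K_j⁻¹`. -/
def calKinv (j : Fin (m + n - 1)) : Uqgl q m n := gen q m n (.K (hi j)) * gen q m n (.Kinv (lo j))

/-- `𝒰_q(sl(m|n))`: the subalgebra generated by the `E_j`, `F_j`, `𝒦_j^{±1}` and `σ`. -/
def Uqsl : Subalgebra k (Uqgl q m n) :=
  Algebra.adjoin k (Set.range (fun j => gen q m n (.E j)) ∪ Set.range (fun j => gen q m n (.F j)) ∪
    Set.range (calK q m n) ∪ Set.range (calKinv q m n) ∪ {gen q m n .sigma})

end relations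

/-- A list of distinguished elements of an algebra: raising elements `e j`, lowering elements `f j`,
toral elements `h i`, and a parity element `s`. -/
structure GenSystem (A : Type*) (J H : Type*) where
  /-- raising elements -/
  e : J → A
  /-- lowering elements -/
  f : J → A
  /-- toral elements -/
  h : H → A
  /-- parity element -/
  s : A

/-- The image of a list of distinguished elements under a map. -/
def GenSystem.map {A B J H : Type*} (D : GenSystem A J H) (φ : A → B) : GenSystem B J H :=
  ⟨fun j => φ (D.e j), fun j => φ (D.f j), fun i => φ (D.h i), φ D.s⟩

section algebras

variable {k : Type*} [Field k] (q : kˣ) (m n : ℕ)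

/-- `E_j, F_j, K_i, σ` in `𝒰_q(gl(m|n))`. -/
def glSys : GenSystem (Uqgl q m n) (Fin (m + n - 1)) (Fin (m + n)) :=
  ⟨fun j => gen q m n (.E j), fun j => gen q m n (.F j), fun i => gen q m n (.K i), gen q m n .sigma⟩

/-- `E_j, F_j, 𝒦_j, σ` in `𝒰_q(sl(m|n))`. -/
def slSys : GenSystem (Uqsl q m n) (Fin (m + n - 1)) (Fin (m + n - 1)) where
  e j := ⟨gen q m n (.E j), Algebra.subset_adjoin (by simp)⟩
  f j := ⟨gen q m n (.F j), Algebra.subset_adjoin (by simp)⟩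
  h j := ⟨calK q m n j, Algebra.subset_adjoin (by simp)⟩
  s := ⟨gen q m n .sigma, Algebra.subset_adjoin (by simp)⟩

variable {m n} in
/-- The additional relations of the restricted quantum algebra: `E_j^ℓ = F_j^ℓ = 0` for even `j`,
`E_j^2 = F_j^2 = 0` for odd `j`, and `h^{2ℓ} = 1` for the toral generators `h`. -/
inductive RestrictedRel {A H : Type*} [Ring A] (D : GenSystem A (Fin (m + n - 1)) H) (l : ℕ) :
    A → A → Prop
  | evenE (j : Fin (m + n - 1)) (hj : (j : ℕ) + 1 ≠ m) : RestrictedRel D l (D.e j ^ l) 0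
  | evenF (j : Fin (m + n - 1)) (hj : (j : ℕ) + 1 ≠ m) : RestrictedRel D l (D.f j ^ l) 0
  | oddE (j : Fin (m + n - 1)) (hj : (j : ℕ) + 1 = m) : RestrictedRel D l (D.e j ^ 2) 0
  | oddF (j : Fin (m + n - 1)) (hj : (j : ℕ) + 1 = m) : RestrictedRel D l (D.f j ^ 2) 0
  | tor (i : H) : RestrictedRel D l (D.h i ^ (2 * l)) 1

/-- The quotient of a ring by the relations `r`. -/
abbrev RelQuot {A : Type*} [Ring A] (r : A → A → Prop) : Type _ := RingQuot r

/-- The restricted algebra `u_q(gl(m|n))`, a quotient of `𝒰_q(gl(m|n))`; here `ℓ = char(q)`. -/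
abbrev uqgl : Type _ := RelQuot (RestrictedRel (glSys q m n) (charQ q))

/-- The restricted algebra `u_q(sl(m|n))`, a quotient of `𝒰_q(sl(m|n))`; here `ℓ = char(q)`. -/
abbrev uqsl : Type _ := RelQuot (RestrictedRel (slSys q m n) (charQ q))

/-- `E_j, F_j, K_i, σ` in `u_q(gl(m|n))`. -/
def glSysR : GenSystem (uqgl q m n) (Fin (m + n - 1)) (Fin (m + n)) :=
  (glSys q m n).map (RingQuot.mkRingHom _)

/-- `E_j, F_j, 𝒦_j, σ` in `u_q(sl(m|n))`. -/
def slSysR : GenSystem (uqsl q m n) (Fin (m + n - 1)) (Fin (m + n - 1)) :=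
  (slSys q m n).map (RingQuot.mkRingHom _)

end algebras

/-! ### Highest weight modules -/

section weights

variable {k : Type*} [Field k] (q : kˣ) {m n : ℕ}

/-- The scalar `q^{(λ, ε_i)}`, where `(ε_i, ε_i) = 1` for even `i` and `-1` for odd `i`: the
eigenvalue of `K_i` on a vector of weight `λ = ∑ λ_i ε_i`. -/
def glChar (lam : Fin (m + n) → ℤ) (i : Fin (m + n)) : k := ((qi q i ^ lam i : kˣ) : k)

/-- The scalar `q^{(λ, ε_j - ε_{j+1})}`: the eigenvalue of `𝒦_j` on a vector of weight `λ`. -/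
def slChar (lam : Fin (m + n) → ℤ) (j : Fin (m + n - 1)) : k :=
  ((qi q (lo j) ^ lam (lo j) * qi q (hi j) ^ (-lam (hi j)) : kˣ) : k)

/-- The parity sign `(-1)^{∑_{i odd} λ_i}` by which `σ` acts on a vector of weight `λ`. -/
def parityChar (k : Type*) [Field k] (lam : Fin (m + n) → ℤ) : k :=
  (((-1 : kˣ) ^ (∑ i : Fin (m + n), if (i : ℕ) < m then 0 else lam i) : kˣ) : k)

end weights

section modules

variable {k A J H : Type*} [Field k] [Ring A] [Algebra k A]

/-- The left ideal generated by all `e j`, all `h i - χ i` and `s - ε`. -/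
def vermaIdeal (D : GenSystem A J H) (χ : H → k) (ε : k) : Submodule A A :=
  Submodule.span A (Set.range D.e ∪ Set.range (fun i => D.h i - algebraMap k A (χ i)) ∪
    {D.s - algebraMap k A ε})

/-- The universal highest weight (Verma) module `M` of highest weight `χ` and parity `ε`. -/
abbrev Verma (D : GenSystem A J H) (χ : H → k) (ε : k) : Type _ := A ⧸ vermaIdeal D χ ε

/-- The largest submodule of the Verma module `M` contained in `∑_j f_j M`, the span of the vectors
strictly below the highest weight vector.  If `q` is not a root of unity, then every proper
submodule of `M` is contained in `∑_j f_j M`, and this is the largest proper submodule. -/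
def vermaRadical (D : GenSystem A J H) (χ : H → k) (ε : k) : Submodule A (Verma D χ ε) :=
  sSup {N | ∀ x ∈ N, x ∈ AddSubgroup.closure {y | ∃ j, ∃ z : Verma D χ ε, y = D.f j • z}}

/-- The irreducible highest weight module `V(χ)` of parity `ε`. -/
abbrev SimpleHW (D : GenSystem A J H) (χ : H → k) (ε : k) : Type _ :=
  Verma D χ ε ⧸ vermaRadical D χ ε

/-- `P` is a simple module, it is generated by its highest weight vector `v` of weight `χ` (and
parity `ε`), and it is isomorphic to `V(χ)`. -/
structure IsSimpleHighestWeight {W : Type*} [AddCommGroup W] [Module k W] [Module A W]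
    (D : GenSystem A J H) (χ : H → k) (ε : k) (P : Submodule A W) (v : W) : Prop where
  simple : IsSimpleModule A P
  ne_zero : v ≠ 0
  raise : ∀ j, D.e j • v = 0
  weight : ∀ i, D.h i • v = χ i • v
  parity : D.s • v = ε • v
  generates : Submodule.span A {v} = P
  iso : Nonempty (P ≃ₗ[A] SimpleHW D χ ε)

end modules

/-! ### The quantum dual Grassmann superalgebra as a module -/

/-- Exponents `⟨μ, α⟩` of the monomials `x^μ ⊗ x^{(α)}`, with `μ_i ∈ {0, 1}` in the even positions
and `α_i ∈ ℕ` in the odd positions. -/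
abbrev Expo (m n : ℕ) : Type := {β : Fin (m + n) → ℕ // ∀ i : Fin (m + n), (i : ℕ) < m → β i ≤ 1}

/-- The space underlying `Ω_q^!(m|n) = Λ_q(m) ⊗ 𝒜_{q⁻¹}(n)`, with its basis of monomials. -/
abbrev Omega (k : Type*) [Field k] (m n : ℕ) : Type _ := Expo m n →₀ k

section omega

variable {k : Type*} [Field k] (q : kˣ) {m n : ℕ}

open Classical in
/-- The monomial `x^μ ⊗ x^{(α)}` with exponent `β = ⟨μ, α⟩`, which is `0` if some `μ_i > 1`. -/
def mono (k : Type*) [Field k] (β : Fin (m + n) → ℕ) : Omega k m n :=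
  if h : ∀ i : Fin (m + n), (i : ℕ) < m → β i ≤ 1 then Finsupp.single ⟨β, h⟩ 1 else 0

/-- The linear operator with prescribed values on the monomials. -/
def ofMono (g : (Fin (m + n) → ℕ) → Omega k m n) : Module.End k (Omega k m n) :=
  Finsupp.linearCombination k (fun b : Expo m n => g b.1)

/-- The scalar `∏_{s < j} c_s^{β_s}`, with `c_s = -q` for even `s` and `c_s = q` for odd `s`; that is,
`(-q)^{ε_j * μ}` for even `j` and `(-q)^{ε_j * μ} q^{ε_j * α}` for odd `j`, where
`ε_j * γ = ∑_{s < j} γ_s`. -/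
def twist (j : Fin (m + n)) (β : Fin (m + n) → ℕ) : k :=
  ∏ s : Fin (m + n), if s < j then (if (s : ℕ) < m then -(q : k) else (q : k)) ^ β s else 1

/-- Left multiplication by `x_j`. -/
def opX (j : Fin (m + n)) : Module.End k (Omega k m n) :=
  ofMono fun β => ((twist q j β)⁻¹ * (if (j : ℕ) < m then 1 else qnum q (β j + 1))) •
    mono k (β + Pi.single j 1)

/-- The quantum derivation `∂_j`. -/
def opD (j : Fin (m + n)) : Module.End k (Omega k m n) :=
  ofMono fun β => if β j = 0 then 0 else twist q j β • mono k (β - Pi.single j 1)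

/-- The automorphism `σ_j`: multiplication by `q^{μ_j}` for even `j`, by `q^{-α_j}` for odd `j`. -/
def opSigma (j : Fin (m + n)) : Module.End k (Omega k m n) :=
  ofMono fun β => ((qi q j : kˣ) : k) ^ β j • mono k β

/-- The inverse of `σ_j`. -/
def opSigmaInv (j : Fin (m + n)) : Module.End k (Omega k m n) :=
  ofMono fun β => (((qi q j)⁻¹ : kˣ) : k) ^ β j • mono k β

/-- The parity automorphism `x^μ ⊗ x^{(α)} ↦ (-1)^{|α|} x^μ ⊗ x^{(α)}`. -/
def opParity (k : Type*) [Field k] (m n : ℕ) : Module.End k (Omega k m n) :=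
  ofMono fun β => (-1 : k) ^ (∑ i : Fin (m + n), if (i : ℕ) < m then 0 else β i) • mono k β

/-- The quantum differential operators by which the generators act:
`E_j = x_j ∂_{j+1} σ_j`, `F_j = σ_j⁻¹ x_{j+1} ∂_j`, `K_i = σ_i`. -/
def genAct : Gen m n → Module.End k (Omega k m n)
  | .E j => opX q (lo j) * opD q (hi j) * opSigma q (lo j)
  | .F j => opSigmaInv q (lo j) * opX q (hi j) * opD q (lo j)
  | .K i => opSigma q i
  | .Kinv i => opSigmaInv q i
  | .sigma => opParity k m n

/-! #### The generators satisfy the defining relations -/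

theorem mono_of_not {β : Fin (m + n) → ℕ} (i : Fin (m + n)) (hi : (i : ℕ) < m) (h : 1 < β i) :
    mono k β = 0 := by
  unfold mono
  rw [dif_neg]
  intro H
  exact absurd (H i hi) (by omega)

theorem ofMono_mono (g : (Fin (m + n) → ℕ) → Omega k m n) (β : Fin (m + n) → ℕ)
    (hg : ∀ i : Fin (m + n), (i : ℕ) < m → 1 < β i → g β = 0) : ofMono g (mono k β) = g β := by
  by_cases h : ∀ i : Fin (m + n), (i : ℕ) < m → β i ≤ 1
  · simp [mono, dif_pos h, ofMono]
  · push Not at h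
    obtain ⟨i, hi, h⟩ := h
    rw [mono_of_not i hi h, map_zero, hg i hi h]

theorem end_ext {f g : Module.End k (Omega k m n)}
    (h : ∀ β : Fin (m + n) → ℕ, (∀ i : Fin (m + n), (i : ℕ) < m → β i ≤ 1) →
      f (mono k β) = g (mono k β)) : f = g := by
  apply Finsupp.lhom_ext'
  intro b
  apply LinearMap.ext_ring
  have := h b.1 b.2
  simpa [mono, dif_pos b.2] using this

/-- A local operator, which only looks at and changes the exponent at position `i`. -/
def loc (i : Fin (m + n)) (c : ℕ → k) (s : ℕ → ℕ) : Module.End k (Omega k m n) :=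
  ofMono fun β => c (β i) • mono k (Function.update β i (s (β i)))

/-- Coefficients of the local raising operator. -/
def upC (i : Fin (m + n)) (r : ℕ) : k :=
  if (i : ℕ) < m then (if r = 0 then 1 else 0) else qnum q (r + 1)

/-- Coefficients of the local lowering operator. -/
def dnC (k : Type*) [Field k] (i : Fin (m + n)) (r : ℕ) : k :=
  if (i : ℕ) < m then (if r = 1 then 1 else 0) else (if r = 0 then 0 else 1)

/-- The local raising operator. -/
def opU (i : Fin (m + n)) : Module.End k (Omega k m n) := loc i (upC q i) (fun r => r + 1)

/-- The local lowering operator. -/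
def opL (k : Type*) [Field k] (i : Fin (m + n)) : Module.End k (Omega k m n) :=
  loc i (dnC k i) (fun r => r - 1)

theorem loc_mono (i : Fin (m + n)) (c : ℕ → k) (s : ℕ → ℕ)
    (hc : (i : ℕ) < m → ∀ r, 1 < r → c r = 0 ∨ 1 < s r) (β : Fin (m + n) → ℕ) :
    loc i c s (mono k β) = c (β i) • mono k (Function.update β i (s (β i))) := by
  apply ofMono_mono
  intro j hj h
  by_cases hij : j = i
  · subst hij
    rcases hc hj _ h with h0 | h0
    · rw [h0, zero_smul]
    · rw [mono_of_not j hj (by simpa using h0), smul_zero]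
  · rw [mono_of_not j hj (by simpa [Function.update_of_ne hij] using h), smul_zero]

theorem opU_mono (i : Fin (m + n)) (β : Fin (m + n) → ℕ) :
    opU q i (mono k β) = upC q i (β i) • mono k (Function.update β i (β i + 1)) :=
  loc_mono i _ _ (fun h r hr => Or.inr (by omega)) β

theorem opL_mono (i : Fin (m + n)) (β : Fin (m + n) → ℕ) :
    opL k i (mono k β) = dnC k i (β i) • mono k (Function.update β i (β i - 1)) :=
  loc_mono i _ _ (fun h r hr => Or.inl (by simp [dnC, h]; omega)) β

theorem opSigma_mono (i : Fin (m + n)) (β : Fin (m + n) → ℕ) :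
    opSigma q i (mono k β) = ((qi q i : kˣ) : k) ^ β i • mono k β :=
  ofMono_mono _ _ fun j hj h => by rw [mono_of_not j hj h, smul_zero]

theorem opSigmaInv_mono (i : Fin (m + n)) (β : Fin (m + n) → ℕ) :
    opSigmaInv q i (mono k β) = (((qi q i)⁻¹ : kˣ) : k) ^ β i • mono k β :=
  ofMono_mono _ _ fun j hj h => by rw [mono_of_not j hj h, smul_zero]

theorem opParity_mono (β : Fin (m + n) → ℕ) :
    opParity k m n (mono k β) =
      (-1 : k) ^ (∑ i : Fin (m + n), if (i : ℕ) < m then 0 else β i) • mono k β :=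
  ofMono_mono _ _ fun j hj h => by rw [mono_of_not j hj h, smul_zero]

theorem opX_mono (j : Fin (m + n)) (β : Fin (m + n) → ℕ) :
    opX q j (mono k β) = ((twist q j β)⁻¹ * (if (j : ℕ) < m then 1 else qnum q (β j + 1))) •
      mono k (β + Pi.single j 1) :=
  ofMono_mono _ _ fun i hi h => by
    rw [mono_of_not i hi (lt_of_lt_of_le h (by simp)), smul_zero]

theorem opD_mono (j : Fin (m + n)) (β : Fin (m + n) → ℕ)
    (hβ : ∀ i : Fin (m + n), (i : ℕ) < m → β i ≤ 1) :
    opD q j (mono k β) =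
      if β j = 0 then 0 else twist q j β • mono k (β - Pi.single j 1) :=
  ofMono_mono _ _ fun i hi h => absurd (hβ i hi) (by omega)

theorem twist_ne (j : Fin (m + n)) (β : Fin (m + n) → ℕ) : twist q j β ≠ 0 := by
  unfold twist
  rw [Finset.prod_ne_zero_iff]
  intro s _
  split_ifs <;> simp

/-- the ratio of the twisting scalars at neighbouring positions -/
theorem twist_hi (j : Fin (m + n - 1)) (β γ : Fin (m + n) → ℕ)
    (h : ∀ s : Fin (m + n), s < lo j → β s = γ s) :
    twist q (hi j) β =
      twist q (lo j) γ * (if (lo j : ℕ) < m then -(q : k) else (q : k)) ^ β (lo j) := by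
  unfold twist
  rw [← Finset.mul_prod_erase Finset.univ _ (Finset.mem_univ (lo j)),
    ← Finset.mul_prod_erase Finset.univ (fun s => if s < lo j then _ else _)
      (Finset.mem_univ (lo j))]
  have h1 : lo j < hi j := by simp [lo, hi]
  simp only [h1, if_true, lt_irrefl, if_false, one_mul]
  rw [mul_comm]
  congr 1
  apply Finset.prod_congr rfl
  intro s hs
  have hs' : s ≠ lo j := by simpa using hs
  have : s < hi j ↔ s < lo j := by
    have : (s : ℕ) ≠ j := fun h => hs' (Fin.ext h)
    simp only [Fin.lt_def, lo, hi]; omega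
  simp only [this]
  split_ifs with h2 <;> first | rfl | rw [h s h2]

theorem lo_ne_hi (j : Fin (m + n - 1)) : lo j ≠ hi j := by
  simp [lo, hi, Fin.ext_iff]

theorem genAct_E (j : Fin (m + n - 1)) :
    genAct q (m := m) (n := n) (.E j) = opU q (lo j) * opL k (hi j) := by
  apply end_ext
  intro β hβ
  have hne := lo_ne_hi j
  simp only [genAct, Module.End.mul_apply]
  rw [opSigma_mono, map_smul, map_smul, opD_mono q _ _ hβ, opL_mono, map_smul, opU_mono]
  by_cases h0 : β (hi j) = 0
  · have : dnC k (hi j) (β (hi j)) = 0 := by simp [dnC, h0]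
    simp only [h0, if_true, map_zero] at this ⊢
    simp [this]
  · have h1 : dnC k (hi j) (β (hi j)) = 1 := by
      unfold dnC
      split_ifs with h2 h3
      · rfl
      · exact absurd (hβ _ h2) (by omega)
      · rfl
    rw [if_neg h0, h1, map_smul, opX_mono, one_smul,
      twist_hi q j β (β - Pi.single (hi j) 1) (by
        intro s hs
        have : s ≠ hi j := by
          rintro rfl
          simp [lo, hi, Fin.lt_def] at hs
        simp [this])]
    have e1 : (β - Pi.single (hi j) 1 : Fin (m + n) → ℕ) (lo j) = β (lo j) := by simp [hne]
    have e2 : β - Pi.single (hi j) 1 + Pi.single (lo j) 1 =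
        Function.update (Function.update β (hi j) (β (hi j) - 1)) (lo j) (β (lo j) + 1) := by
      funext s
      by_cases hs : s = lo j
      · subst hs; simp [hne]
      · by_cases hs' : s = hi j
        · subst hs'; simp [hs]
        · simp [hs, hs']
    rw [e1, e2, Function.update_of_ne hne, smul_smul, smul_smul]
    have ht := twist_ne q (lo j) (β - Pi.single (hi j) 1)
    by_cases hm : (lo j : ℕ) < m
    · have hb := hβ _ hm
      rcases Nat.lt_or_ge 0 (β (lo j)) with hb0 | hb0
      · rw [mono_of_not (lo j) hm (by simpa using hb0), smul_zero, smul_zero]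
      · have hb1 : β (lo j) = 0 := by omega
        congr 1
        simp [upC, hm, hb1, ht]
    · congr 1
      simp only [upC, hm, if_false, qi]
      have hq : (q : k) ≠ 0 := q.ne_zero
      rw [Units.val_inv_eq_inv_val, inv_pow]
      field_simp

theorem genAct_F (j : Fin (m + n - 1)) :
    genAct q (m := m) (n := n) (.F j) = opU q (hi j) * opL k (lo j) := by
  apply end_ext
  intro β hβ
  have hne := lo_ne_hi j
  simp only [genAct, Module.End.mul_apply]
  rw [opD_mono q _ _ hβ, opL_mono, map_smul, opU_mono]
  by_cases h0 : β (lo j) = 0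
  · have : dnC k (lo j) (β (lo j)) = 0 := by simp [dnC, h0]
    simp only [h0, if_true, map_zero] at this ⊢
    simp [this]
  · have h1 : dnC k (lo j) (β (lo j)) = 1 := by
      unfold dnC
      split_ifs with h2 h3
      · rfl
      · exact absurd (hβ _ h2) (by omega)
      · rfl
    rw [if_neg h0, h1, map_smul, map_smul, opX_mono, map_smul, opSigmaInv_mono, one_smul,
      twist_hi q j (β - Pi.single (lo j) 1) β (by
        intro s hs
        have : s ≠ lo j := ne_of_lt hs
        simp [this])]
    have e1 : (β - Pi.single (lo j) 1 : Fin (m + n) → ℕ) (hi j) = β (hi j) := by simp [hne.symm]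
    have e2 : β - Pi.single (lo j) 1 + Pi.single (hi j) 1 =
        Function.update (Function.update β (lo j) (β (lo j) - 1)) (hi j) (β (hi j) + 1) := by
      funext s
      by_cases hs : s = lo j
      · subst hs; simp [hne]
      · by_cases hs' : s = hi j
        · subst hs'; simp [hs]
        · simp [hs, hs']
    have e3 : (β - Pi.single (lo j) 1 : Fin (m + n) → ℕ) (lo j) = β (lo j) - 1 := by simp
    rw [e1, e2, e3, Function.update_of_ne hne.symm, Function.update_of_ne hne, Function.update_self,
      smul_smul, smul_smul]
    have ht := twist_ne q (lo j) β
    obtain ⟨r, hr⟩ : ∃ r, β (lo j) = r + 1 := ⟨β (lo j) - 1, by omega⟩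
    have hq : (q : k) ≠ 0 := q.ne_zero
    have key : twist q (lo j) β * ((twist q (lo j) β *
        (if (lo j : ℕ) < m then -(q : k) else (q : k)) ^ (β (lo j) - 1))⁻¹ *
          (if (hi j : ℕ) < m then 1 else qnum q (β (hi j) + 1)) *
          (((qi q (lo j))⁻¹ : kˣ) : k) ^ (β (lo j) - 1)) =
        (if (hi j : ℕ) < m then 1 else qnum q (β (hi j) + 1)) := by
      by_cases hm : (lo j : ℕ) < m
      · have hb := hβ _ hm
        have : β (lo j) - 1 = 0 := by omega
        rw [this]
        simp only [pow_zero, mul_one]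
        field_simp
      · simp only [hm, if_false, qi, inv_inv]
        field_simp
    rw [mul_assoc, key]
    by_cases hm : (hi j : ℕ) < m
    · have hb := hβ _ hm
      rcases Nat.lt_or_ge 0 (β (hi j)) with hb0 | hb0
      · rw [mono_of_not (hi j) hm (by simpa using hb0), smul_zero, smul_zero]
      · have hb1 : β (hi j) = 0 := by omega
        simp [upC, hm, hb1]
    · simp [upC, hm]

theorem opU_comm (i j : Fin (m + n)) : opU q i * opU q j = opU q j * opU q i := by
  by_cases h : i = j
  · rw [h]
  apply end_ext
  intro β _
  simp only [Module.End.mul_apply, opU_mono, map_smul, smul_smul]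
  rw [Function.update_of_ne h, Function.update_of_ne (Ne.symm h),
    Function.update_comm (Ne.symm h), mul_comm]

theorem opL_comm (i j : Fin (m + n)) : opL k i * opL k j = opL k j * opL k i := by
  by_cases h : i = j
  · rw [h]
  apply end_ext
  intro β _
  simp only [Module.End.mul_apply, opL_mono, map_smul, smul_smul]
  rw [Function.update_of_ne h, Function.update_of_ne (Ne.symm h),
    Function.update_comm (Ne.symm h), mul_comm]

theorem opUL_comm {i j : Fin (m + n)} (h : i ≠ j) : opU q i * opL k j = opL k j * opU q i := by
  apply end_ext
  intro β _
  simp only [Module.End.mul_apply, opL_mono, opU_mono, map_smul, smul_smul]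
  rw [Function.update_of_ne h.symm, Function.update_of_ne h, Function.update_comm h, mul_comm]

theorem opU_sq {i : Fin (m + n)} (h : (i : ℕ) < m) : opU q i * opU q i = 0 := by
  apply end_ext
  intro β _
  simp only [Module.End.mul_apply, opU_mono, map_smul, smul_smul]
  by_cases h1 : β i = 0 <;> simp [upC, h, h1]

theorem opL_sq {i : Fin (m + n)} (h : (i : ℕ) < m) : opL k i * opL k i = 0 := by
  apply end_ext
  intro β _
  simp only [Module.End.mul_apply, opL_mono, map_smul, smul_smul]
  by_cases h1 : β i = 1 <;> simp [dnC, h, h1]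

theorem qnum_zero : qnum q 0 = 0 := by simp [qnum]

theorem qsub_ne (hq : q ^ 2 ≠ 1) : (q : k) - (q : k)⁻¹ ≠ 0 := by
  intro h
  apply hq
  ext
  have h0 : (q : k) ≠ 0 := q.ne_zero
  field_simp at h
  push_cast
  linear_combination h

theorem qnum_one (hq : q ^ 2 ≠ 1) : qnum q 1 = 1 := by
  simp [qnum, qsub_ne q hq]

theorem qnum_rec (r : ℕ) :
    qnum q (r + 2) - ((q : k) + (q : k)⁻¹) * qnum q (r + 1) + qnum q r = 0 := by
  have h0 : (q : k) ≠ 0 := q.ne_zero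
  have h1 : (q : k) * (q : k)⁻¹ = 1 := mul_inv_cancel₀ h0
  unfold qnum
  rw [← mul_div_assoc, ← sub_div, ← add_div, div_eq_zero_iff]
  left
  simp only [pow_succ]
  linear_combination (-(q : k) ^ r + (q : k)⁻¹ ^ r) * h1

theorem bose_LLU {i : Fin (m + n)} (h : ¬ (i : ℕ) < m) :
    opL k i * (opL k i * opU q i) - ((q : k) + (q : k)⁻¹) • (opL k i * (opU q i * opL k i)) +
      opU q i * (opL k i * opL k i) = 0 := by
  apply end_ext
  intro β _
  simp only [Module.End.mul_apply, LinearMap.add_apply, LinearMap.sub_apply, LinearMap.smul_apply,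
    opU_mono, opL_mono, map_smul, smul_smul, Function.update_self, Function.update_idem,
    LinearMap.zero_apply]
  rcases hb : β i with _ | _ | r
  · simp [dnC, h]
  · have := qnum_rec q 0
    simp only [dnC, upC, h, qnum_zero] at this ⊢
    simp only [if_false, Nat.reduceAdd, Nat.reduceSub]
    simp only [if_true, if_false, zero_add, one_ne_zero, mul_zero, zero_mul,
      zero_smul, add_zero, OfNat.ofNat_ne_zero, mul_one, one_mul] at this ⊢
    rw [← sub_smul, this, zero_smul]
  · have := qnum_rec q (r + 1)
    simp only [dnC, upC, h, if_false]
    simp only [Nat.add_sub_cancel, Nat.add_eq_zero_iff, one_ne_zero, and_false, if_false,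
      mul_one, one_mul]
    rw [← sub_smul, ← add_smul, this, zero_smul]

theorem bose_UUL {i : Fin (m + n)} (h : ¬ (i : ℕ) < m) :
    opU q i * (opU q i * opL k i) - ((q : k) + (q : k)⁻¹) • (opU q i * (opL k i * opU q i)) +
      opL k i * (opU q i * opU q i) = 0 := by
  apply end_ext
  intro β _
  simp only [Module.End.mul_apply, LinearMap.add_apply, LinearMap.sub_apply, LinearMap.smul_apply,
    opU_mono, opL_mono, map_smul, smul_smul, Function.update_self, Function.update_idem,
    LinearMap.zero_apply]
  rcases hb : β i with _ | r
  · have := qnum_rec q 0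
    simp only [qnum_zero, add_zero] at this
    simp only [dnC, upC, h, if_false]
    simp only [Nat.add_sub_cancel, Nat.add_eq_zero_iff, one_ne_zero, and_false, if_false, if_true,
      mul_one, zero_mul, zero_smul, zero_sub, zero_add] at this ⊢
    rw [← neg_smul, ← add_smul]
    have e : -(((q : k) + (q : k)⁻¹) * (qnum q 1 * qnum q 1)) + qnum q 1 * qnum q (1 + 1) = 0 := by
      linear_combination qnum q 1 * this
    rw [e, zero_smul]
  · have := qnum_rec q (r + 1)
    simp only [dnC, upC, h, if_false]
    simp only [Nat.add_sub_cancel, Nat.add_eq_zero_iff, one_ne_zero, and_false, if_false,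
      mul_one, one_mul]
    rw [← sub_smul, ← add_smul]
    have e : qnum q (r + 1) * qnum q (r + 1 + 1) -
        ((q : k) + (q : k)⁻¹) * (qnum q (r + 1 + 1) * qnum q (r + 1 + 1)) +
        qnum q (r + 1 + 1) * qnum q (r + 1 + 1 + 1) = 0 := by
      linear_combination qnum q (r + 1 + 1) * this
    rw [e, zero_smul]

theorem sigma_U (i j : Fin (m + n)) :
    opSigma q i * opU q j =
      ((qi q i ^ (if i = j then 1 else 0 : ℤ) : kˣ) : k) • (opU q j * opSigma q i) := by
  apply end_ext
  intro β _
  simp only [Module.End.mul_apply, LinearMap.smul_apply, opU_mono, opSigma_mono, map_smul,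
    smul_smul]
  by_cases h : i = j
  · subst h
    congr 1
    simp only [Function.update_self, if_true, zpow_one, pow_succ]
    ring
  · simp only [Function.update_of_ne h, if_neg h, zpow_zero, Units.val_one]
    congr 1
    ring

theorem sigma_L (i j : Fin (m + n)) :
    opSigma q i * opL k j =
      ((qi q i ^ (-(if i = j then 1 else 0) : ℤ) : kˣ) : k) • (opL k j * opSigma q i) := by
  apply end_ext
  intro β _
  simp only [Module.End.mul_apply, LinearMap.smul_apply, opL_mono, opSigma_mono, map_smul,
    smul_smul]
  by_cases h : i = j
  · subst h
    congr 1
    simp only [Function.update_self, if_true, zpow_neg, zpow_one, Units.val_inv_eq_inv_val]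
    have h0 : ((qi q i : kˣ) : k) ≠ 0 := Units.ne_zero _
    rcases hb : β i with _ | r
    · simp [dnC]
    · rw [Nat.add_sub_cancel, pow_succ]
      field_simp
  · simp only [Function.update_of_ne h, if_neg h, neg_zero, zpow_zero, Units.val_one]
    congr 1
    ring

theorem sigma_UL (i a b : Fin (m + n)) :
    opSigma q i * (opU q a * opL k b) =
      ((qi q i ^ ((if i = a then 1 else 0) - (if i = b then 1 else 0) : ℤ) : kˣ) : k) •
        (opU q a * opL k b * opSigma q i) := by
  rw [← mul_assoc, sigma_U, smul_mul_assoc, mul_assoc, sigma_L, mul_smul_comm, smul_smul,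
    ← Units.val_mul, ← zpow_add, sub_eq_add_neg, mul_assoc]

theorem parity_UL (a b : Fin (m + n)) (hab : a ≠ b) :
    opParity k m n * (opU q a * opL k b) * opParity k m n =
      (-1 : k) ^ ((if (a : ℕ) < m then 0 else 1) + (if (b : ℕ) < m then 0 else 1)) •
        (opU q a * opL k b) := by
  apply end_ext
  intro β _
  simp only [Module.End.mul_apply, LinearMap.smul_apply, opL_mono, opU_mono, opParity_mono,
    map_smul, smul_smul]
  rcases hb : β b with _ | r
  · simp [dnC]
  rw [Nat.add_sub_cancel, Function.update_of_ne hab]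
  congr 1
  have key : ((∑ i : Fin (m + n), if (i : ℕ) < m then 0 else β i) +
      (∑ i : Fin (m + n), if (i : ℕ) < m then 0 else
        Function.update (Function.update β b r) a (β a + 1) i)) + 2 * (if (b : ℕ) < m then 0 else 1)
      = 2 * (∑ i : Fin (m + n), if (i : ℕ) < m then 0 else β i) +
      ((if (a : ℕ) < m then 0 else 1) + (if (b : ℕ) < m then 0 else 1)) := by
    have h1 : (∑ i : Fin (m + n), if (i : ℕ) < m then 0 else
        Function.update (Function.update β b r) a (β a + 1) i) + (if (b : ℕ) < m then 0 else 1) =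
        (∑ i : Fin (m + n), if (i : ℕ) < m then 0 else β i) + (if (a : ℕ) < m then 0 else 1) := by
      have hb' : (if (b : ℕ) < m then 0 else 1) =
          ∑ i : Fin (m + n), if i = b then (if (b : ℕ) < m then 0 else 1) else 0 := by simp
      have ha' : (if (a : ℕ) < m then 0 else 1) =
          ∑ i : Fin (m + n), if i = a then (if (a : ℕ) < m then 0 else 1) else 0 := by simp
      rw [hb', ha', ← Finset.sum_add_distrib, ← Finset.sum_add_distrib]
      apply Finset.sum_congr rfl
      intro i _
      by_cases hia : i = a
      · subst hia
        simp only [Function.update_self, if_neg hab, if_true]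
        split_ifs <;> omega
      · by_cases hib : i = b
        · subst hib
          simp only [Function.update_of_ne hia, Function.update_self, if_neg hia, if_true, hb]
          split_ifs <;> omega
        · simp only [Function.update_of_ne hia, Function.update_of_ne hib, if_neg hia, if_neg hib]
    omega
  have e : (-1 : k) ^ ((∑ i : Fin (m + n), if (i : ℕ) < m then 0 else β i) +
      (∑ i : Fin (m + n), if (i : ℕ) < m then 0 else
        Function.update (Function.update β b r) a (β a + 1) i)) =
      (-1 : k) ^ ((if (a : ℕ) < m then 0 else 1) + (if (b : ℕ) < m then 0 else 1)) := by
    have := congrArg (fun N => (-1 : k) ^ N) key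
    simpa only [pow_add, pow_mul, neg_one_sq, one_pow, mul_one, one_mul] using this
  rw [← e, pow_add]
  ring

theorem qnum_sub_rel (a b : ℕ) :
    qnum q a * qnum q (b + 1) - qnum q (a + 1) * qnum q b =
      ((q : k) - (q : k)⁻¹)⁻¹ * ((q : k) ^ a * (q : k)⁻¹ ^ b - (q : k) ^ b * (q : k)⁻¹ ^ a) := by
  have h0 : (q : k) ≠ 0 := q.ne_zero
  have h1 : (q : k) * (q : k)⁻¹ = 1 := mul_inv_cancel₀ h0
  unfold qnum
  by_cases h : (q : k) - (q : k)⁻¹ = 0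
  · simp [h]
  · have h2 : ((q : k) - (q : k)⁻¹)⁻¹ * ((q : k) - (q : k)⁻¹) = 1 := inv_mul_cancel₀ h
    simp only [div_eq_mul_inv, pow_succ]
    generalize ((q : k) - (q : k)⁻¹)⁻¹ = w at *
    generalize (q : k)⁻¹ = p at *
    linear_combination (w * ((q : k) ^ a * p ^ b - (q : k) ^ b * p ^ a)) * h2

theorem EF_rel (hq : q ^ 2 ≠ 1) (j : Fin (m + n - 1)) :
    opU q (lo j) * opL k (hi j) * (opU q (hi j) * opL k (lo j)) -
      (-1 : k) ^ (par (m := m) j * par (m := m) j) •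
        (opU q (hi j) * opL k (lo j) * (opU q (lo j) * opL k (hi j))) =
      (((qi q (lo j) : kˣ) : k) - ((qi q (lo j) : kˣ) : k)⁻¹)⁻¹ •
        (opSigma q (lo j) * opSigmaInv q (hi j) - opSigma q (hi j) * opSigmaInv q (lo j)) := by
  have hne := lo_ne_hi j
  apply end_ext
  intro β hβ
  simp only [Module.End.mul_apply, LinearMap.smul_apply, LinearMap.sub_apply, opL_mono, opU_mono,
    opSigma_mono, opSigmaInv_mono, map_smul, smul_smul]
  simp only [Function.update_of_ne hne, Function.update_of_ne hne.symm, Function.update_self]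
  have hl := hβ (lo j)
  have hh := hβ (hi j)
  have hlm : (lo j : ℕ) = j := rfl
  have hhm : (hi j : ℕ) = j + 1 := rfl
  set a := β (lo j) with ha
  set b := β (hi j) with hb
  have E1 : (dnC k (lo j) a * (upC q (hi j) b * (dnC k (hi j) (b + 1) * upC q (lo j) (a - 1)))) •
      mono k (Function.update (Function.update (Function.update (Function.update β (lo j) (a - 1))
        (hi j) (b + 1)) (hi j) (b + 1 - 1)) (lo j) (a - 1 + 1)) =
      (dnC k (lo j) a * (upC q (hi j) b * (dnC k (hi j) (b + 1) * upC q (lo j) (a - 1)))) •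
        mono k β := by
    rcases Nat.eq_zero_or_pos a with h | h
    · simp [dnC, h]
    · congr 2
      funext s
      by_cases h1 : s = lo j
      · subst h1; simp only [Function.update_self]; omega
      · by_cases h2 : s = hi j
        · subst h2; simp [h1, hb]
        · simp [h1, h2]
  have E2 : (dnC k (hi j) b * (upC q (lo j) a * (dnC k (lo j) (a + 1) * upC q (hi j) (b - 1)))) •
      mono k (Function.update (Function.update (Function.update (Function.update β (hi j) (b - 1))
        (lo j) (a + 1)) (lo j) (a + 1 - 1)) (hi j) (b - 1 + 1)) =
      (dnC k (hi j) b * (upC q (lo j) a * (dnC k (lo j) (a + 1) * upC q (hi j) (b - 1)))) •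
        mono k β := by
    rcases Nat.eq_zero_or_pos b with h | h
    · simp [dnC, h]
    · congr 2
      funext s
      by_cases h1 : s = lo j
      · subst h1; simp [hne, ha]
      · by_cases h2 : s = hi j
        · subst h2; simp only [Function.update_self]; omega
        · simp [h1, h2]
  simp only [mul_assoc, mul_smul] at E1 E2 ⊢
  rw [E1, E2]
  simp only [← mul_smul, ← sub_smul]
  congr 1
  have q1 := qnum_one q hq
  have q0 := qnum_zero q
  have hqq := qsub_ne q hq
  have h0 : (q : k) ≠ 0 := q.ne_zero
  have S := qnum_sub_rel q a b
  have up1 : ∀ i : Fin (m + n), ¬ (i : ℕ) < m → ∀ r,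
      dnC k i r * upC q i (r - 1) = qnum q r := by
    intro i hi r
    rcases r with _ | r <;> simp [dnC, upC, hi, q0]
  have up2 : ∀ i : Fin (m + n), ¬ (i : ℕ) < m → ∀ r,
      upC q i r * dnC k i (r + 1) = qnum q (r + 1) := by
    intro i hi r
    simp [dnC, upC, hi]
  have up3 : ∀ i : Fin (m + n), (i : ℕ) < m → ∀ r, r ≤ 1 →
      dnC k i r * upC q i (r - 1) = qnum q r := by
    intro i hi r hr
    interval_cases r <;> simp [dnC, upC, hi, q0, q1]
  have up4 : ∀ i : Fin (m + n), (i : ℕ) < m → ∀ r, r ≤ 1 →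
      upC q i r * dnC k i (r + 1) = 1 - qnum q r := by
    intro i hi r hr
    interval_cases r <;> simp [dnC, upC, hi, q0, q1]
  have L1 : dnC k (lo j) a * (upC q (hi j) b * (dnC k (hi j) (b + 1) * upC q (lo j) (a - 1))) =
      (dnC k (lo j) a * upC q (lo j) (a - 1)) * (upC q (hi j) b * dnC k (hi j) (b + 1)) := by ring
  have L2 : dnC k (hi j) b * (upC q (lo j) a * (dnC k (lo j) (a + 1) * upC q (hi j) (b - 1))) =
      (dnC k (hi j) b * upC q (hi j) (b - 1)) * (upC q (lo j) a * dnC k (lo j) (a + 1)) := by ring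
  rw [L1, L2]
  by_cases c1 : (hi j : ℕ) < m
  · have c2 : (lo j : ℕ) < m := by omega
    have cp : par (m := m) j = 0 := by simp only [par]; rw [if_neg]; omega
    have hl' := hl c2
    have hh' := hh c1
    rw [up3 _ c2 _ hl', up4 _ c1 _ hh', up3 _ c1 _ hh', up4 _ c2 _ hl', cp]
    simp only [qi, c1, c2, if_true, Units.val_inv_eq_inv_val]
    clear_value a b
    interval_cases a <;> interval_cases b <;> simp [q0, q1] at S ⊢ <;> linear_combination S
  · by_cases c2 : (lo j : ℕ) < m
    · have cp : par (m := m) j = 1 := by simp only [par]; rw [if_pos]; omega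
      have hl' := hl c2
      rw [up3 _ c2 _ hl', up2 _ c1, up1 _ c1, up4 _ c2 _ hl', cp]
      simp only [qi, c1, c2, if_true, if_false, Units.val_inv_eq_inv_val, inv_inv, mul_one, pow_one]
      clear_value a b
      interval_cases a
      · rw [q0]
        simp only [qnum, div_eq_mul_inv]
        ring
      · rw [q1]
        simp only [qnum, div_eq_mul_inv]
        ring
    · have cp : par (m := m) j = 0 := by simp only [par]; rw [if_neg]; omega
      rw [up1 _ c2, up2 _ c1, up1 _ c1, up2 _ c2, cp]
      simp only [qi, c1, c2, if_false, Units.val_inv_eq_inv_val, inv_inv, mul_zero, pow_zero,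
        one_mul]
      have : (q : k)⁻¹ - (q : k) ≠ 0 := by
        intro h; apply hqq; linear_combination -h
      have e : ((q : k)⁻¹ - (q : k))⁻¹ = -((q : k) - (q : k)⁻¹)⁻¹ := by
        rw [← neg_sub, inv_neg]
      rw [e]
      linear_combination S

set_option linter.unusedSimpArgs false in
theorem serre_aux {R : Type*} [Ring R] [Algebra k R] (c : k) {A B B' C X Y : R}
    (hX : X = A * B) (hY : Y = B' * C) (ab : Commute B A) (ab' : Commute B' A) (ac : Commute C A)
    (bc : Commute C B) (h : A * A = 0 ∨ B * (B * B') - c • (B * (B' * B)) + B' * (B * B) = 0) :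
    X * X * Y - c • (X * Y * X) + Y * X * X = 0 := by
  have e : ∀ {x y : R}, Commute x y → ∀ z, x * (y * z) = y * (x * z) := fun h z => by
    rw [← mul_assoc, h.eq, mul_assoc]
  have E : X * X * Y - c • (X * Y * X) + Y * X * X =
      A * A * ((B * (B * B') - c • (B * (B' * B)) + B' * (B * B)) * C) := by
    subst hX hY
    simp only [add_mul, sub_mul, mul_add, mul_sub, smul_mul_assoc, mul_smul_comm, mul_assoc,
      ab.eq, ab'.eq, ac.eq, bc.eq, e ab, e ab', e ac, e bc]
  rcases h with h | h
  · rw [E, h, zero_mul]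
  · rw [E, h, zero_mul, mul_zero]

set_option linter.unusedSimpArgs false in
theorem super_aux {R : Type*} [Ring R] [Algebra k R] (c : k) {A B B' C C' D X Y Z : R}
    (hX : X = A * B) (hY : Y = B' * C) (hZ : Z = C' * D)
    (ab' : Commute B' A) (ac : Commute C A) (ac' : Commute C' A)
    (ad : Commute D A) (bc : Commute C B) (bc' : Commute C' B) (bd : Commute D B)
    (bc1 : Commute C B') (bc1' : Commute C' B') (bd1 : Commute D B') (cd : Commute D C)
    (hB : B' * B' = 0) (h : C * (C * C') - c • (C * (C' * C)) + C' * (C * C) = 0) :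
    X * Y * Z * Y + Y * X * Y * Z + Z * Y * X * Y + Y * Z * Y * X - c • (Y * X * Z * Y) = 0 := by
  have e : ∀ {x y : R}, Commute x y → ∀ z, x * (y * z) = y * (x * z) := fun h z => by
    rw [← mul_assoc, h.eq, mul_assoc]
  have hB2 : ∀ z, B' * (B' * z) = 0 := fun z => by rw [← mul_assoc, hB, zero_mul]
  have E : X * Y * Z * Y + Y * X * Y * Z + Z * Y * X * Y + Y * Z * Y * X - c • (Y * X * Z * Y) =
      A * (B' * (B * B')) * ((C * (C * C') - c • (C * (C' * C)) + C' * (C * C)) * D) := by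
    subst hX hY hZ
    simp only [add_mul, sub_mul, mul_add, mul_sub, smul_mul_assoc, mul_smul_comm, mul_assoc,
      ab'.eq, ac.eq, bc.eq, ac'.eq, ad.eq, bc'.eq, bd.eq, bc1.eq, bc1'.eq, bd1.eq, cd.eq,
      e ab', e ac, e bc, e ac', e ad, e bc', e bd, e bc1, e bc1', e bd1, e cd, hB2, mul_zero,
      zero_mul, add_zero, zero_add]
    abel
  rw [E, h, zero_mul, mul_zero]

theorem genAct_rel (hq : q ^ 2 ≠ 1) {x y : FreeAlgebra k (Gen m n)} (h : Rel q m n x y) :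
    FreeAlgebra.lift k (genAct q (m := m) (n := n)) x =
      FreeAlgebra.lift k (genAct q (m := m) (n := n)) y := by
  have hlo : ∀ j : Fin (m + n - 1), (lo j : ℕ) = j := fun _ => rfl
  have hhi : ∀ j : Fin (m + n - 1), (hi j : ℕ) = j + 1 := fun _ => rfl
  have cUU : ∀ i j : Fin (m + n), Commute (opU q i) (opU q j) := opU_comm q
  have cLL : ∀ i j : Fin (m + n), Commute (opL k i) (opL k j) := opL_comm
  have cUL : ∀ i j : Fin (m + n), i ≠ j → Commute (opU q i) (opL k j) := fun _ _ h => opUL_comm q h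
  have hK : ∀ i, genAct q (m := m) (n := n) (.K i) = opSigma q i := fun _ => rfl
  have hKi : ∀ i, genAct q (m := m) (n := n) (.Kinv i) = opSigmaInv q i := fun _ => rfl
  have hS : genAct q (m := m) (n := n) .sigma = opParity k m n := rfl
  cases h <;> simp only [fE, fF, fK, fKinv, fS, map_mul, map_sub, map_add, map_smul, map_one,
    map_zero, FreeAlgebra.lift_ι_apply, genAct_E, genAct_F, hK, hKi, hS]
  case KK i j =>
    apply end_ext
    intro β _
    simp only [Module.End.mul_apply, opSigma_mono, map_smul, smul_smul, mul_comm]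
  case KKinv i =>
    apply end_ext
    intro β _
    simp [opSigma_mono, opSigmaInv_mono, smul_smul]
  case KinvK i =>
    apply end_ext
    intro β _
    simp [opSigma_mono, opSigmaInv_mono, smul_smul]
  case KE i j => rw [sigma_UL]; rfl
  case KF i j =>
    rw [sigma_UL]
    congr 4
    simp [pairing]
  case EF_ne i j hij =>
    have hv : (i : ℕ) ≠ j := fun h => hij (Fin.ext h)
    have hp : par (m := m) i * par (m := m) j = 0 := by
      simp only [par]; split_ifs <;> omega
    rw [hp, pow_zero, one_smul, sub_eq_zero]
    have e1 : opL k (hi i) * opU q (hi j) = opU q (hi j) * opL k (hi i) :=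
      (opUL_comm q (by simp [Fin.ext_iff, hhi]; omega)).symm
    have e2 : opU q (lo i) * opL k (lo j) = opL k (lo j) * opU q (lo i) :=
      opUL_comm q (by simp [Fin.ext_iff, hlo]; omega)
    have e3 : opU q (lo i) * opU q (hi j) = opU q (hi j) * opU q (lo i) := opU_comm q _ _
    have e4 : opL k (hi i) * opL k (lo j) = opL k (lo j) * opL k (hi i) := opL_comm _ _
    calc opU q (lo i) * opL k (hi i) * (opU q (hi j) * opL k (lo j))
        = opU q (lo i) * (opL k (hi i) * opU q (hi j)) * opL k (lo j) := by noncomm_ring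
      _ = (opU q (lo i) * opU q (hi j)) * (opL k (hi i) * opL k (lo j)) := by
          rw [e1]; noncomm_ring
      _ = opU q (hi j) * (opU q (lo i) * opL k (lo j)) * opL k (hi i) := by
          rw [e3, e4]; noncomm_ring
      _ = _ := by rw [e2]; noncomm_ring
  case EF j => exact EF_rel q hq j
  case EE i j hij =>
    refine Commute.mul_left (Commute.mul_right ?_ ?_) (Commute.mul_right ?_ ?_)
    · exact cUU _ _
    · exact cUL _ _ (by simp only [ne_eq, Fin.ext_iff, hlo, hhi]; omega)
    · exact (cUL _ _ (by simp only [ne_eq, Fin.ext_iff, hlo, hhi]; omega)).symm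
    · exact cLL _ _
  case FF i j hij =>
    refine Commute.mul_left (Commute.mul_right ?_ ?_) (Commute.mul_right ?_ ?_)
    · exact cUU _ _
    · exact cUL _ _ (by simp only [ne_eq, Fin.ext_iff, hlo, hhi]; omega)
    · exact (cUL _ _ (by simp only [ne_eq, Fin.ext_iff, hlo, hhi]; omega)).symm
    · exact cLL _ _
  case serreE i j hij him =>
    have n1 := lo_ne_hi i
    rcases hij with hij | hij
    · have e : lo j = hi i := by simp only [Fin.ext_iff, hlo, hhi]; omega
      have n2 : lo i ≠ hi j := by simp only [ne_eq, Fin.ext_iff, hlo, hhi]; omega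
      have n3 : hi i ≠ hi j := by simp only [ne_eq, Fin.ext_iff, hhi]; omega
      rw [e]
      refine serre_aux (R := Module.End k (Omega k m n)) _
        (A := opU q (lo i)) (B := opL k (hi i)) (B' := opU q (hi i)) (C := opL k (hi j)) rfl rfl (cUL _ _ n1).symm (cUU _ _) (cUL _ _ n2).symm (cLL _ _) ?_
      by_cases hm : (lo i : ℕ) < m
      · exact Or.inl (opU_sq q hm)
      · exact Or.inr (bose_LLU q (by rw [hhi]; rw [hlo] at hm; omega))
    · have e : hi j = lo i := by simp only [Fin.ext_iff, hlo, hhi]; omega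
      have n2 : lo j ≠ hi i := by simp only [ne_eq, Fin.ext_iff, hlo, hhi]; omega
      have n3 : lo j ≠ lo i := by simp only [ne_eq, Fin.ext_iff, hlo]; omega
      rw [e]
      refine serre_aux (R := Module.End k (Omega k m n)) _
        (A := opL k (hi i)) (B := opU q (lo i)) (B' := opL k (lo i)) (C := opU q (lo j)) (cUL _ _ n1).eq (cUL _ _ n3).eq (cUL _ _ n1) (cLL _ _) (cUL _ _ n2)
        (cUU _ _) ?_
      by_cases hm : (hi i : ℕ) < m
      · exact Or.inl (opL_sq hm)
      · exact Or.inr (bose_UUL q (by rw [hlo]; rw [hhi] at hm; omega))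
  case serreF i j hij him =>
    have n1 := lo_ne_hi i
    rcases hij with hij | hij
    · have e : lo j = hi i := by simp only [Fin.ext_iff, hlo, hhi]; omega
      have n2 : hi j ≠ lo i := by simp only [ne_eq, Fin.ext_iff, hlo, hhi]; omega
      have n3 : hi j ≠ hi i := by simp only [ne_eq, Fin.ext_iff, hhi]; omega
      rw [e]
      refine serre_aux (R := Module.End k (Omega k m n)) _
        (A := opL k (lo i)) (B := opU q (hi i)) (B' := opL k (hi i)) (C := opU q (hi j)) (cUL _ _ n1.symm).eq (cUL _ _ n3).eq (cUL _ _ n1.symm) (cLL _ _)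
        (cUL _ _ n2) (cUU _ _) ?_
      by_cases hm : (lo i : ℕ) < m
      · exact Or.inl (opL_sq hm)
      · exact Or.inr (bose_UUL q (by rw [hhi]; rw [hlo] at hm; omega))
    · have e : hi j = lo i := by simp only [Fin.ext_iff, hlo, hhi]; omega
      have n2 : hi i ≠ lo j := by simp only [ne_eq, Fin.ext_iff, hlo, hhi]; omega
      rw [e]
      refine serre_aux (R := Module.End k (Omega k m n)) _
        (A := opU q (hi i)) (B := opL k (lo i)) (B' := opU q (lo i)) (C := opL k (lo j)) rfl rfl (cUL _ _ n1.symm).symm (cUU _ _) (cUL _ _ n2).symm (cLL _ _) ?_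
      by_cases hm : (hi i : ℕ) < m
      · exact Or.inl (opU_sq q hm)
      · exact Or.inr (bose_LLU q (by rw [hlo]; rw [hhi] at hm; omega))
  case sqE i him =>
    have hm : (lo i : ℕ) < m := by rw [hlo]; omega
    rw [Commute.mul_mul_mul_comm (cUL _ _ (lo_ne_hi i)).symm, opU_sq q hm, zero_mul]
  case sqF i him =>
    have hm : (lo i : ℕ) < m := by rw [hlo]; omega
    rw [Commute.mul_mul_mul_comm (cUL _ _ (lo_ne_hi i).symm).symm, opL_sq hm, mul_zero]
  case superE a b c hab hb hbc =>
    have e1 : hi a = lo b := by simp only [Fin.ext_iff, hlo, hhi]; omega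
    have e2 : hi b = lo c := by simp only [Fin.ext_iff, hlo, hhi]; omega
    rw [e1, e2]
    have n1 : lo a ≠ lo b := by simp only [ne_eq, Fin.ext_iff, hlo]; omega
    have n2 : lo a ≠ lo c := by simp only [ne_eq, Fin.ext_iff, hlo]; omega
    have n3 : lo a ≠ hi c := by simp only [ne_eq, Fin.ext_iff, hlo, hhi]; omega
    have n4 : lo b ≠ lo c := by simp only [ne_eq, Fin.ext_iff, hlo]; omega
    have n5 : lo b ≠ hi c := by simp only [ne_eq, Fin.ext_iff, hlo, hhi]; omega
    exact super_aux (R := Module.End k (Omega k m n)) _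
      (A := opU q (lo a)) (B := opL k (lo b)) (B' := opU q (lo b)) (C := opL k (lo c))
      (C' := opU q (lo c)) (D := opL k (hi c))
      rfl rfl rfl (cUU _ _) (cUL _ _ n2).symm (cUU _ _)
      (cUL _ _ n3).symm (cLL _ _) (cUL _ _ n4.symm) (cLL _ _) (cUL _ _ n4).symm (cUU _ _)
      (cUL _ _ n5).symm (cLL _ _) (opU_sq q (by rw [hlo]; omega))
      (bose_LLU q (by rw [hlo]; omega))
  case superF a b c hab hb hbc =>
    have e1 : hi a = lo b := by simp only [Fin.ext_iff, hlo, hhi]; omega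
    have e2 : hi b = lo c := by simp only [Fin.ext_iff, hlo, hhi]; omega
    rw [e1, e2]
    have n1 : lo b ≠ lo a := by simp only [ne_eq, Fin.ext_iff, hlo]; omega
    have n2 : lo c ≠ lo a := by simp only [ne_eq, Fin.ext_iff, hlo]; omega
    have n3 : hi c ≠ lo a := by simp only [ne_eq, Fin.ext_iff, hlo, hhi]; omega
    have n4 : lo c ≠ lo b := by simp only [ne_eq, Fin.ext_iff, hlo]; omega
    have n5 : hi c ≠ lo b := by simp only [ne_eq, Fin.ext_iff, hlo, hhi]; omega
    have n6 : hi c ≠ lo c := (lo_ne_hi c).symm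
    exact super_aux (R := Module.End k (Omega k m n)) _
      (A := opL k (lo a)) (B := opU q (lo b)) (B' := opL k (lo b)) (C := opU q (lo c))
      (C' := opL k (lo c)) (D := opU q (hi c))
      (cUL _ _ n1).eq (cUL _ _ n4).eq (cUL _ _ n6).eq (cLL _ _)
      (cUL _ _ n2) (cLL _ _) (cUL _ _ n3) (cUU _ _) (cUL _ _ n4.symm).symm (cUU _ _) (cUL _ _ n4)
      (cLL _ _) (cUL _ _ n5) (cUU _ _) (opL_sq (by rw [hlo]; omega))
      (bose_UUL q (by rw [hlo]; omega))
  case sigma_sq =>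
    apply end_ext
    intro β _
    simp [opParity_mono, smul_smul, ← pow_add, ← two_mul, pow_mul]
  case sigmaE j =>
    rw [parity_UL _ _ _ (lo_ne_hi j)]
    have := hlo j
    have := hhi j
    by_cases c1 : (hi j : ℕ) < m
    · have c2 : (lo j : ℕ) < m := by omega
      have c3 : par (m := m) j = 0 := by simp only [par]; rw [if_neg]; omega
      simp [c1, c2, c3]
    · by_cases c2 : (lo j : ℕ) < m
      · have c3 : par (m := m) j = 1 := by simp only [par]; rw [if_pos]; omega
        simp [c1, c2, c3]
      · have c3 : par (m := m) j = 0 := by simp only [par]; rw [if_neg]; omega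
        simp [c1, c2, c3]
  case sigmaF j =>
    rw [parity_UL _ _ _ (lo_ne_hi j).symm]
    have := hlo j
    have := hhi j
    by_cases c1 : (hi j : ℕ) < m
    · have c2 : (lo j : ℕ) < m := by omega
      have c3 : par (m := m) j = 0 := by simp only [par]; rw [if_neg]; omega
      simp [c1, c2, c3]
    · by_cases c2 : (lo j : ℕ) < m
      · have c3 : par (m := m) j = 1 := by simp only [par]; rw [if_pos]; omega
        simp [c1, c2, c3]
      · have c3 : par (m := m) j = 0 := by simp only [par]; rw [if_neg]; omega
        simp [c1, c2, c3]
  case sigmaK i =>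
    apply end_ext
    intro β _
    simp only [Module.End.mul_apply, opSigma_mono, opParity_mono, map_smul, smul_smul]
    congr 1
    rw [mul_left_comm, ← pow_add, ← two_mul, pow_mul]
    simp

/-! #### The module structures -/

/-- The action of `𝒰_q(gl(m|n))` on `Ω_q^!(m|n)`. -/
def act [hq : Fact (q ^ 2 ≠ 1)] (m n : ℕ) : Uqgl q m n →ₐ[k] Module.End k (Omega k m n) :=
  RingQuot.liftAlgHom k ⟨FreeAlgebra.lift k (genAct q), fun _ _ h => genAct_rel q hq.out h⟩

theorem act_gen [Fact (q ^ 2 ≠ 1)] (g : Gen m n) : act q m n (gen q m n g) = genAct q g := by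
  simp [act, gen]

/-- `Ω_q^!(m|n)` as a `𝒰_q(gl(m|n))`-module (and hence, by restriction, as a
`𝒰_q(sl(m|n))`-module). -/
instance omegaModule [Fact (q ^ 2 ≠ 1)] : Module (Uqgl q m n) (Omega k m n) :=
  Module.compHom (Omega k m n) (act q m n).toRingHom

theorem smul_omega [Fact (q ^ 2 ≠ 1)] (u : Uqgl q m n) (w : Omega k m n) : u • w = act q m n u w :=
  rfl

instance omegaTower [Fact (q ^ 2 ≠ 1)] : IsScalarTower k (Uqgl q m n) (Omega k m n) :=
  ⟨fun c u w => by rw [smul_omega, smul_omega, map_smul, LinearMap.smul_apply]⟩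

/-- The homogeneous component `Ω_q^!(m|n)^{(t)}`, spanned by the monomials of degree `t`. -/
def omegaHom (k : Type*) [Field k] (m n t : ℕ) : Submodule k (Omega k m n) :=
  Submodule.span k {w | ∃ β : Fin (m + n) → ℕ, ∑ i, β i = t ∧ w = mono k β}

/-- The span of the monomials with `μ_i ≤ 1`, with `α_i < l`, and with exponent at least `r` at the
position `a`. -/
def capSpan (k : Type*) [Field k] {m n : ℕ} (l : ℕ) (a : Fin (m + n)) (r : ℕ) :
    Submodule k (Omega k m n) :=
  Submodule.span k {w | ∃ β : Fin (m + n) → ℕ, (∀ i : Fin (m + n), (i : ℕ) < m → β i ≤ 1) ∧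
    (∀ i : Fin (m + n), m ≤ (i : ℕ) → β i < l) ∧ r ≤ β a ∧ w = mono k β}

/-- The linear span of the monomials `x^μ ⊗ x^{(α)}` with all `α_i < l`. -/
def cap (k : Type*) [Field k] (m n l : ℕ) : Submodule k (Omega k m n) :=
  Submodule.span k {w | ∃ β : Fin (m + n) → ℕ,
    (∀ i : Fin (m + n), m ≤ (i : ℕ) → β i < l) ∧ w = mono k β}

theorem mono_ind {P : Omega k m n → Prop} (β : Fin (m + n) → ℕ) (h0 : P 0)
    (h : (∀ i : Fin (m + n), (i : ℕ) < m → β i ≤ 1) → P (mono k β)) : P (mono k β) := by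
  by_cases hb : ∀ i : Fin (m + n), (i : ℕ) < m → β i ≤ 1
  · exact h hb
  · push Not at hb
    obtain ⟨i, hi, hb⟩ := hb
    rw [mono_of_not i hi hb]
    exact h0

theorem capSpan_zero (l : ℕ) (a : Fin (m + n)) : capSpan k l a 0 = cap k m n l := by
  apply le_antisymm
  · apply Submodule.span_le.2
    rintro _ ⟨β, -, h2, -, rfl⟩
    exact Submodule.subset_span ⟨β, h2, rfl⟩
  · apply Submodule.span_le.2
    rintro _ ⟨β, h2, rfl⟩
    exact mono_ind (P := fun w => w ∈ (capSpan k l a 0 : Set (Omega k m n))) β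
      (Submodule.zero_mem _) fun h => Submodule.subset_span ⟨β, h, h2, Nat.zero_le _, rfl⟩

theorem capSpan_mono (l : ℕ) (a : Fin (m + n)) {r s : ℕ} (h : r ≤ s) :
    capSpan k l a s ≤ capSpan k l a r := by
  apply Submodule.span_mono
  rintro _ ⟨β, h1, h2, h3, rfl⟩
  exact ⟨β, h1, h2, h.trans h3, rfl⟩

theorem capSpan_top {l : ℕ} (hl : 2 < l) (a : Fin (m + n)) : capSpan k l a l = ⊥ := by
  rw [capSpan, Submodule.span_eq_bot]
  rintro _ ⟨β, h1, h2, h3, rfl⟩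
  exfalso
  by_cases ha : (a : ℕ) < m
  · have := h1 a ha; omega
  · have := h2 a (by omega); omega

theorem UL_capSpan {l : ℕ} (_hl : 2 < l) (hql : qnum q l = 0) {a b : Fin (m + n)} (hab : a ≠ b)
    (r : ℕ) (w : Omega k m n) (hw : w ∈ capSpan k l a r) :
    (opU q a * opL k b) w ∈ capSpan k l a (r + 1) := by
  induction hw using Submodule.span_induction with
  | zero => simp
  | add x y _ _ hx hy => rw [map_add]; exact Submodule.add_mem _ hx hy
  | smul c x _ hx => rw [map_smul]; exact Submodule.smul_mem _ _ hx
  | mem x hx =>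
    obtain ⟨β, h1, h2, h3, rfl⟩ := hx
    rw [Module.End.mul_apply, opL_mono, map_smul, opU_mono, Function.update_of_ne hab]
    apply Submodule.smul_mem
    by_cases hz : upC q a (β a) = 0
    · rw [hz, zero_smul]; exact Submodule.zero_mem _
    apply Submodule.smul_mem
    refine Submodule.subset_span ⟨_, ?_, ?_, ?_, rfl⟩
    · intro i hi
      by_cases hia : i = a
      · subst hia
        rw [Function.update_self]
        by_contra hc
        apply hz
        simp only [upC, hi, if_true]
        rw [if_neg]; omega
      · by_cases hib : i = b
        · subst hib
          rw [Function.update_of_ne hia, Function.update_self]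
          have := h1 i hi; omega
        · rw [Function.update_of_ne hia, Function.update_of_ne hib]
          exact h1 i hi
    · intro i hi
      by_cases hia : i = a
      · subst hia
        rw [Function.update_self]
        have := h2 i hi
        by_contra hc
        apply hz
        simp only [upC, not_lt.2 hi, if_false]
        rw [show β i + 1 = l by omega, hql]
      · by_cases hib : i = b
        · subst hib
          rw [Function.update_of_ne hia, Function.update_self]
          have := h2 i hi; omega
        · rw [Function.update_of_ne hia, Function.update_of_ne hib]
          exact h2 i hi
    · rw [Function.update_self]; omega

theorem UL_pow {l : ℕ} (hl : 2 < l) (hql : qnum q l = 0) {a b : Fin (m + n)} (hab : a ≠ b)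
    (w : Omega k m n) (hw : w ∈ cap k m n l) (r : ℕ) :
    ((opU q a * opL k b) ^ r) w ∈ capSpan k l a r := by
  induction r with
  | zero => rw [capSpan_zero]; simpa using hw
  | succ r ih =>
    rw [pow_succ']
    exact UL_capSpan q hl hql hab r _ ih

theorem diag_cap {l : ℕ} {f : Module.End k (Omega k m n)}
    (hf : ∀ β, ∃ c : k, f (mono k β) = c • mono k β) (w : Omega k m n) (hw : w ∈ cap k m n l) :
    f w ∈ cap k m n l := by
  induction hw using Submodule.span_induction with
  | zero => simp
  | add x y _ _ hx hy => rw [map_add]; exact Submodule.add_mem _ hx hy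
  | smul c x _ hx => rw [map_smul]; exact Submodule.smul_mem _ _ hx
  | mem x hx =>
    obtain ⟨β, h2, rfl⟩ := hx
    obtain ⟨c, hc⟩ := hf β
    rw [hc]
    exact Submodule.smul_mem _ _ (Submodule.subset_span ⟨β, h2, rfl⟩)

theorem genAct_cap {l : ℕ} (hl : 2 < l) (hql : qnum q l = 0) (g : Gen m n) (w : Omega k m n)
    (hw : w ∈ cap k m n l) : genAct q g w ∈ cap k m n l := by
  have key : ∀ a b : Fin (m + n), a ≠ b → (opU q a * opL k b) w ∈ cap k m n l := by
    intro a b hab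
    rw [← capSpan_zero l a] at hw ⊢
    exact capSpan_mono l a (Nat.zero_le _) (UL_capSpan q hl hql hab 0 w hw)
  cases g with
  | E j => rw [genAct_E]; exact key _ _ (lo_ne_hi j)
  | F j => rw [genAct_F]; exact key _ _ (lo_ne_hi j).symm
  | K i => exact diag_cap (fun β => ⟨_, opSigma_mono q i β⟩) w hw
  | Kinv i => exact diag_cap (fun β => ⟨_, opSigmaInv_mono q i β⟩) w hw
  | sigma => exact diag_cap (fun β => ⟨_, opParity_mono β⟩) w hw

theorem act_cap [Fact (q ^ 2 ≠ 1)] {l : ℕ} (hl : 2 < l) (hql : qnum q l = 0) (u : Uqgl q m n)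
    (w : Omega k m n) (hw : w ∈ cap k m n l) : act q m n u w ∈ cap k m n l := by
  obtain ⟨x, rfl⟩ := RingQuot.mkAlgHom_surjective k (Rel q m n) u
  induction x using FreeAlgebra.induction generalizing w with
  | grade0 c =>
    rw [AlgHom.commutes, AlgHom.commutes]
    exact Submodule.smul_mem _ _ hw
  | grade1 g =>
    have := act_gen q g
    rw [gen] at this
    rw [this]
    exact genAct_cap q hl hql g w hw
  | mul a b ha hb =>
    rw [map_mul, map_mul]
    exact ha _ (hb _ hw)
  | add a b ha hb =>
    rw [map_add, map_add]
    exact Submodule.add_mem _ (ha _ hw) (hb _ hw)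

theorem qnum_charQ (h : 2 < charQ q) : qnum q (charQ q) = 0 := by
  have hne : {r : ℕ | 0 < r ∧ qnum q r = 0}.Nonempty := by
    by_contra hc
    rw [Set.not_nonempty_iff_eq_empty] at hc
    simp [charQ, hc] at h
  exact (Nat.sInf_mem hne).2

/-- The quantum restricted dual Grassmann superalgebra `Ω_q^!(m|n, 𝟏)`, where `ℓ = char(q) > 2`: the
span of the monomials `x^μ ⊗ x^{(α)}` with all `α_i ≤ ℓ - 1`, as a `𝒰_q(gl(m|n))`-submodule. -/
def OmegaR (q : kˣ) (m n : ℕ) [Fact (q ^ 2 ≠ 1)] [hl : Fact (2 < charQ q)] :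
    Submodule (Uqgl q m n) (Omega k m n) where
  carrier := cap k m n (charQ q)
  add_mem' := (cap k m n (charQ q)).add_mem
  zero_mem' := (cap k m n (charQ q)).zero_mem
  smul_mem' u w hw := act_cap q hl.out (qnum_charQ q hl.out) u w hw

theorem q_pow_charQ [hq : Fact (q ^ 2 ≠ 1)] (h : 2 < charQ q) : q ^ (2 * charQ q) = 1 := by
  have h1 := qnum_charQ q h
  rw [qnum, div_eq_zero_iff, or_iff_left (qsub_ne q hq.out)] at h1
  have h0 : (q : k) ≠ 0 := q.ne_zero
  ext
  rw [inv_pow] at h1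
  field_simp at h1
  push_cast
  rw [pow_mul, ← pow_mul, mul_comm, pow_mul]
  linear_combination h1

theorem diag_pow {f : Module.End k (Omega k m n)} {d : (Fin (m + n) → ℕ) → k}
    (hf : ∀ β, f (mono k β) = d β • mono k β) {N : ℕ} (hd : ∀ β, d β ^ N = 1) : f ^ N = 1 := by
  apply end_ext
  intro β _
  have : ∀ r : ℕ, (f ^ r) (mono k β) = d β ^ r • mono k β := by
    intro r
    induction r with
    | zero => simp
    | succ r ih => rw [pow_succ', Module.End.mul_apply, ih, map_smul, hf, smul_smul, pow_succ]
  rw [this, hd, one_smul, Module.End.one_apply]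

theorem qi_pow {N : ℕ} (h : q ^ N = 1) (i : Fin (m + n)) (b : ℕ) :
    ((((qi q i : kˣ) : k) ^ b) ^ N = 1) ∧ (((((qi q i)⁻¹ : kˣ) : k) ^ b) ^ N = 1) := by
  have h1 : (qi q i) ^ N = 1 := by
    unfold qi
    split_ifs <;> simp [h]
  constructor
  · rw [← pow_mul, mul_comm, pow_mul, ← Units.val_pow_eq_pow_val, h1]; simp
  · rw [← pow_mul, mul_comm, pow_mul, ← Units.val_pow_eq_pow_val, inv_pow, h1]; simp

theorem restricted_aux [hq : Fact (q ^ 2 ≠ 1)] [hl : Fact (2 < charQ q)] (g : Gen m n)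
    (w : Omega k m n) (hw : w ∈ cap k m n (charQ q)) (a b : Fin (m + n)) (hab : a ≠ b)
    (hg : genAct q g = opU q a * opL k b) : gen q m n g ^ charQ q • w = 0 := by
  have h := UL_pow q hl.out (qnum_charQ q hl.out) hab w hw (charQ q)
  rw [capSpan_top hl.out, Submodule.mem_bot] at h
  rw [smul_omega, map_pow, act_gen, hg, h]

theorem gl_restricted [hq : Fact (q ^ 2 ≠ 1)] [hl : Fact (2 < charQ q)] (x y : Uqgl q m n)
    (h : RestrictedRel (glSys q m n) (charQ q) x y) (w : OmegaR q m n) : x • w = y • w := by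
  apply Subtype.ext
  have hw : (w : Omega k m n) ∈ cap k m n (charQ q) := w.2
  change x • (w : Omega k m n) = y • (w : Omega k m n)
  cases h with
  | evenE j hj =>
    rw [zero_smul]; exact restricted_aux q _ _ hw _ _ (lo_ne_hi j) (genAct_E q j)
  | evenF j hj =>
    rw [zero_smul]; exact restricted_aux q _ _ hw _ _ (lo_ne_hi j).symm (genAct_F q j)
  | oddE j hj =>
    have := genAct_rel q hq.out (Rel.sqE (q := q) (n := n) j hj)
    simp only [fE, map_mul, FreeAlgebra.lift_ι_apply, map_zero] at this
    change gen q m n (.E j) ^ 2 • (w : Omega k m n) = _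
    rw [smul_omega, map_pow, act_gen, pow_two, this, zero_smul, LinearMap.zero_apply]
  | oddF j hj =>
    have := genAct_rel q hq.out (Rel.sqF (q := q) (n := n) j hj)
    simp only [fF, map_mul, FreeAlgebra.lift_ι_apply, map_zero] at this
    change gen q m n (.F j) ^ 2 • (w : Omega k m n) = _
    rw [smul_omega, map_pow, act_gen, pow_two, this, zero_smul, LinearMap.zero_apply]
  | tor i =>
    change gen q m n (.K i) ^ (2 * charQ q) • (w : Omega k m n) = _
    have := diag_pow (f := opSigma q i) (fun β => opSigma_mono q i β)
      (N := 2 * charQ q) (fun β => (qi_pow q (q_pow_charQ q hl.out) i (β i)).1)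
    rw [smul_omega, map_pow, act_gen]
    change (opSigma q i ^ (2 * charQ q)) _ = _
    rw [this, one_smul, Module.End.one_apply]

theorem sl_restricted [hq : Fact (q ^ 2 ≠ 1)] [hl : Fact (2 < charQ q)] (x y : Uqsl q m n)
    (h : RestrictedRel (slSys q m n) (charQ q) x y) (w : OmegaR q m n) : x • w = y • w := by
  change (x : Uqgl q m n) • w = (y : Uqgl q m n) • w
  cases h with
  | evenE j hj => exact gl_restricted q _ _ (.evenE j hj) w
  | evenF j hj => exact gl_restricted q _ _ (.evenF j hj) w
  | oddE j hj => exact gl_restricted q _ _ (.oddE j hj) w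
  | oddF j hj => exact gl_restricted q _ _ (.oddF j hj) w
  | tor j =>
    apply Subtype.ext
    change calK q m n j ^ (2 * charQ q) • (w : Omega k m n) = (1 : Uqgl q m n) • (w : Omega k m n)
    have := diag_pow (f := opSigma q (lo j) * opSigmaInv q (hi j))
      (d := fun β => ((((qi q (hi j))⁻¹ : kˣ) : k) ^ β (hi j)) * ((qi q (lo j) : kˣ) : k) ^ β (lo j))
      (fun β => by
        rw [Module.End.mul_apply, opSigmaInv_mono, map_smul, opSigma_mono, smul_smul])
      (N := 2 * charQ q) (fun β => by
        rw [mul_pow, (qi_pow q (q_pow_charQ q hl.out) _ _).1,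
          (qi_pow q (q_pow_charQ q hl.out) _ _).2, mul_one])
    rw [smul_omega, map_pow, calK, map_mul, act_gen, act_gen]
    change ((opSigma q (lo j) * opSigmaInv q (hi j)) ^ (2 * charQ q)) _ = _
    rw [this, one_smul, Module.End.one_apply]

/-- A module over `A` on which the relations `r` hold is a module over the quotient of `A` by `r`. -/
abbrev quotModule {A W : Type*} [Ring A] [AddCommGroup W] [Module A W] (r : A → A → Prop)
    (h : ∀ x y, r x y → ∀ w : W, x • w = y • w) : Module (RelQuot r) W :=
  Module.compHom W (RingQuot.lift (⟨Module.toAddMonoidEnd A W, fun x y hxy =>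
    AddMonoidHom.ext (h x y hxy)⟩ : {f : A →+* AddMonoid.End W // ∀ ⦃x y⦄, r x y → f x = f y}))

/-- `Ω_q^!(m|n, 𝟏)` as a module over the restricted algebra `u_q(gl(m|n))`. -/
instance omegaRModuleGl [Fact (q ^ 2 ≠ 1)] [Fact (2 < charQ q)] :
    Module (uqgl q m n) (OmegaR q m n) :=
  quotModule (A := Uqgl q m n) (W := OmegaR q m n) (RestrictedRel (glSys q m n) (charQ q))
    (gl_restricted q)

/-- `Ω_q^!(m|n, 𝟏)` as a module over the restricted algebra `u_q(sl(m|n))`. -/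
instance omegaRModuleSl [Fact (q ^ 2 ≠ 1)] [Fact (2 < charQ q)] :
    Module (uqsl q m n) (OmegaR q m n) :=
  quotModule (A := Uqsl q m n) (W := OmegaR q m n) (RestrictedRel (slSys q m n) (charQ q))
    (sl_restricted q)

/-- The homogeneous component `Ω_q^!(m|n, 𝟏)^{(t)}`, spanned by its monomials of degree `t`. -/
def omegaRHom (q : kˣ) (m n t : ℕ) [Fact (q ^ 2 ≠ 1)] [Fact (2 < charQ q)] :
    Submodule k (OmegaR q m n) :=
  Submodule.span k {w | ∃ β : Fin (m + n) → ℕ, (∀ i : Fin (m + n), m ≤ (i : ℕ) → β i < charQ q) ∧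
    ∑ i, β i = t ∧ (w : Omega k m n) = mono k β}

end omega

/-- The tuple `ε_r = (0, …, 0, 1, 0, …, 0)` with its `1` at the one-based position `r`. -/
def eps (m n r : ℕ) : Fin (m + n) → ℕ := fun i => if (i : ℕ) + 1 = r then 1 else 0

/-- The fundamental weight `ω_r = ε_1 + ⋯ + ε_r`. -/
def omegaWt (m n r : ℕ) : Fin (m + n) → ℕ := ∑ s ∈ Finset.Icc 1 r, eps m n s

/-- A tuple of natural numbers regarded as a weight in `⨁ ℤ ε_i`. -/
def toWt {m n : ℕ} (β : Fin (m + n) → ℕ) : Fin (m + n) → ℤ := fun i => (β i : ℤ)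


/-- The highest weight `ω_m + (t - m) ε_{m+1}`, for `t > m` and `q` generic. -/
def genWt (m n t : ℕ) : Fin (m + n) → ℕ := omegaWt m n m + (t - m) • eps m n (m + 1)

/-- The highest weight `ω_m + (ℓ - 1) ε_{m+1} + ⋯ + (ℓ - 1) ε_{m+(i-1)} + r ε_{m+i}`. -/
def resWt (m n l i r : ℕ) : Fin (m + n) → ℕ :=
  omegaWt m n m + ∑ p ∈ Finset.Ico 1 i, (l - 1) • eps m n (m + p) + r • eps m n (m + i)
end QSuper

end

/-!
Each homogeneous component has a basis of monomials, and on monomials the generators act as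
`E_j ↦ x_j ∂_{j+1}`, `F_j ↦ x_{j+1} ∂_j` up to nonzero scalars: they move one unit of the exponent
between neighbouring positions. A move fails only at a wall, when the source position is empty or
the target position is full. Even positions are full at `1`. Odd positions are never full if `q` is
generic, and are full at `ℓ - 1` if `char(q) = ℓ`, because `[ℓ] = 0` while `[r] ≠ 0` for
`0 < r < ℓ`. The two cases are treated together by a cutoff `L` on the odd exponents (`IsCutoff`):
`L = ℓ` in the second case, and `L = t + 2` in degree `t`, out of reach, in the first one.

*Simplicity.* Since `E_j` is injective on the monomials it does not kill, a vector killed by `E_j`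
is a combination of monomials killed by `E_j`. A monomial killed by all `E_j` is filled up from the
left, and there is only one of these in each degree (`IsGreedy.unique`). Raising a nonzero vector as
long as possible thus ends at a multiple of this monomial (`IsMonomial.top_mem`), and lowering leads
from it to every other monomial (`IsMonomial.basis_mem`). Weights play no role in this, which is
essential over `sl(m|n)`, whose weights do not separate the monomials in general.

*Identification with `V(λ)`.* In all four algebras the toral elements commute with the `F_j` up to
scalars and `E_i F_j` equals `F_j E_i` up to a scalar and a toral term (`GenSystem.IsTriangular`).
This much suffices for `M(λ) = k v + ∑_j F_j M(λ)` (`verma_decomp`). If `Q` is a simple quotient of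
`M(λ)` and a linear functional on `Q` separates the image of `v` from `∑_j F_j Q`, then the kernel
of `M(λ) → Q` is contained in `∑_j F_j M(λ)`; it contains every other submodule with this property,
because the image of such a submodule in `Q` is a submodule that misses the image of `v`. So `Q` is
`V(λ)` (`nonempty_equiv_simpleHW`). For a component the functional is the coordinate of the highest
monomial, which is never produced by lowering.
-/

noncomputable section

namespace QSuper

/-! ### Highest weight modules over algebras with a triangular structure -/

section highest_weight

variable {k A J H : Type*} [Field k] [Ring A] [Algebra k A]

/-- The toral generators `h i`, their inverses, and the parity element. -/
def GenSystem.toral (D : GenSystem A J H) (hinv : H → A) : Set A :=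
  Set.range D.h ∪ Set.range hinv ∪ {D.s}

/-- The part of a triangular decomposition `A = A⁻A⁰A⁺` that highest weight theory uses: `A` is
generated by the `e j`, the `f j` and the toral elements (with `hinv i` inverse to `h i`), toral
elements commute with each `f j` up to a scalar, and `e i`, `f j` commute up to a scalar and a
toral term. -/
structure GenSystem.IsTriangular (k : Type*) [Field k] [Algebra k A] (D : GenSystem A J H)
    (hinv : H → A) : Prop where
  adjoin_eq_top : Algebra.adjoin k (Set.range D.e ∪ Set.range D.f ∪ D.toral hinv) = ⊤
  hinv_mul : ∀ i, hinv i * D.h i = 1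
  toral_mul_f : ∀ x ∈ D.toral hinv, ∀ j, ∃ c : k, x * D.f j = c • (D.f j * x)
  e_mul_f : ∀ i j, ∃ c : k, ∃ u ∈ Algebra.adjoin k (D.toral hinv),
    D.e i * D.f j = c • (D.f j * D.e i) + u

/-- A triangular structure passes to quotient algebras. -/
theorem GenSystem.IsTriangular.map {B : Type*} [Ring B] [Algebra k B] {D : GenSystem A J H}
    {hinv : H → A} (hD : D.IsTriangular k hinv) (φ : A →ₐ[k] B) (hφ : Function.Surjective φ) :
    (D.map φ).IsTriangular k (fun i => φ (hinv i)) := by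
  have ht : (D.map φ).toral (fun i => φ (hinv i)) = φ '' D.toral hinv := by
    simp only [GenSystem.toral, GenSystem.map, Set.image_union, ← Set.range_comp,
      Set.image_singleton]
    rfl
  refine ⟨?_, fun i => ?_, ?_, fun i j => ?_⟩
  · have : Set.range (D.map φ).e ∪ Set.range (D.map φ).f ∪ (D.map φ).toral (fun i => φ (hinv i)) =
        φ '' (Set.range D.e ∪ Set.range D.f ∪ D.toral hinv) := by
      rw [ht]
      simp only [GenSystem.map, Set.image_union, ← Set.range_comp]
      rfl
    rw [this, Algebra.adjoin_image, hD.adjoin_eq_top, Algebra.map_top,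
      (AlgHom.range_eq_top φ).2 hφ]
  · simp only [GenSystem.map]
    rw [← map_mul, hD.hinv_mul, map_one]
  · rw [ht]
    rintro _ ⟨x, hx, rfl⟩ j
    obtain ⟨c, hc⟩ := hD.toral_mul_f x hx j
    exact ⟨c, by simp only [GenSystem.map]; rw [← map_mul, hc, map_smul, map_mul]⟩
  · obtain ⟨c, u, hu, h⟩ := hD.e_mul_f i j
    refine ⟨c, φ u, ?_, ?_⟩
    · rw [ht, Algebra.adjoin_image]
      exact ⟨u, hu, rfl⟩
    · simp only [GenSystem.map]
      rw [← map_mul, h, map_add, map_smul, map_mul]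

section stable

variable {W : Type*} [AddCommGroup W] [Module k W] [Module A W] [IsScalarTower k A W]

theorem smul_mem_of_mem_adjoin {S : Set A} {V : Submodule k W}
    (h : ∀ a ∈ S, ∀ w ∈ V, a • w ∈ V) {a : A} (ha : a ∈ Algebra.adjoin k S) :
    ∀ w ∈ V, a • w ∈ V := by
  induction ha using Algebra.adjoin_induction with
  | mem x hx => exact h x hx
  | algebraMap r => intro w hw; rw [algebraMap_smul]; exact V.smul_mem r hw
  | add x y _ _ hx hy => intro w hw; rw [add_smul]; exact V.add_mem (hx w hw) (hy w hw)
  | mul x y _ _ hx hy => intro w hw; rw [mul_smul]; exact hx _ (hy w hw)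

/-- A subspace that is stable under generators of the algebra is a submodule. -/
theorem exists_submodule_of_stable {S : Set A} (hS : Algebra.adjoin k S = ⊤) (V : Submodule k W)
    (h : ∀ a ∈ S, ∀ w ∈ V, a • w ∈ V) : ∃ P : Submodule A W, (P : Set W) = V :=
  ⟨{ carrier := V
     add_mem' := V.add_mem
     zero_mem' := V.zero_mem
     smul_mem' := fun a w hw =>
      smul_mem_of_mem_adjoin h (hS ▸ Algebra.mem_top : a ∈ Algebra.adjoin k S) w hw }, rfl⟩

end stable

/-- The generator of the Verma module. -/
def vac (D : GenSystem A J H) (χ : H → k) (ε : k) : Verma D χ ε :=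
  Submodule.Quotient.mk 1

section verma

variable {D : GenSystem A J H} {hinv : H → A} {χ : H → k} {ε : k}

theorem smul_vac (a : A) : a • vac D χ ε = Submodule.Quotient.mk a := by
  rw [vac, ← Submodule.Quotient.mk_smul, smul_eq_mul, mul_one]

theorem e_smul_vac (j : J) : D.e j • vac D χ ε = 0 := by
  rw [smul_vac, Submodule.Quotient.mk_eq_zero]
  exact Submodule.subset_span (Or.inl (Or.inl ⟨j, rfl⟩))

theorem h_smul_vac (i : H) : D.h i • vac D χ ε = χ i • vac D χ ε := by
  rw [← algebraMap_smul A (χ i), smul_vac, smul_vac, Submodule.Quotient.eq]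
  exact Submodule.subset_span (Or.inl (Or.inr ⟨i, rfl⟩))

theorem s_smul_vac : D.s • vac D χ ε = ε • vac D χ ε := by
  rw [← algebraMap_smul A ε, smul_vac, smul_vac, Submodule.Quotient.eq]
  exact Submodule.subset_span (Or.inr rfl)

theorem toral_smul_vac (hD : D.IsTriangular k hinv) (hχ : ∀ i, χ i ≠ 0) {x : A}
    (hx : x ∈ D.toral hinv) : ∃ c : k, x • vac D χ ε = c • vac D χ ε := by
  rcases hx with (⟨i, rfl⟩ | ⟨i, rfl⟩) | rfl
  · exact ⟨_, h_smul_vac i⟩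
  · refine ⟨(χ i)⁻¹, ?_⟩
    have h : hinv i • (D.h i • vac D χ ε) = vac D χ ε := by
      rw [← mul_smul, hD.hinv_mul, one_smul]
    rw [h_smul_vac, smul_comm] at h
    nth_rewrite 2 [← h]
    rw [smul_smul, inv_mul_cancel₀ (hχ i), one_smul]
  · exact ⟨_, s_smul_vac⟩

/-- The span of the vectors `f_{j_1} ⋯ f_{j_r} • v` with `v` the generator of the Verma module. -/
def lowerSpan (D : GenSystem A J H) (χ : H → k) (ε : k) : Submodule k (Verma D χ ε) :=
  Submodule.span k (Set.range fun l : List J => (l.map D.f).prod • vac D χ ε)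

theorem lowerSpan_word (l : List J) : (l.map D.f).prod • vac D χ ε ∈ lowerSpan D χ ε :=
  Submodule.subset_span ⟨l, rfl⟩

/-- To show that `lowerSpan` is stable under `a` it suffices to look at words. -/
theorem lowerSpan_stable {a : A}
    (h : ∀ l : List J, a • (l.map D.f).prod • vac D χ ε ∈ lowerSpan D χ ε) :
    ∀ w ∈ lowerSpan D χ ε, a • w ∈ lowerSpan D χ ε := by
  intro w hw
  induction hw using Submodule.span_induction with
  | zero => rw [smul_zero]; exact Submodule.zero_mem _
  | add x y _ _ hx hy => rw [smul_add]; exact Submodule.add_mem _ hx hy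
  | smul c x _ hx => rw [smul_comm]; exact Submodule.smul_mem _ _ hx
  | mem x hx => obtain ⟨l, rfl⟩ := hx; exact h l

theorem lowerSpan_f (j : J) : ∀ w ∈ lowerSpan D χ ε, D.f j • w ∈ lowerSpan D χ ε :=
  lowerSpan_stable fun l => by
    rw [← mul_smul]
    exact lowerSpan_word (j :: l)

theorem lowerSpan_toral (hD : D.IsTriangular k hinv) (hχ : ∀ i, χ i ≠ 0) {x : A}
    (hx : x ∈ D.toral hinv) : ∀ w ∈ lowerSpan D χ ε, x • w ∈ lowerSpan D χ ε :=
  lowerSpan_stable fun l => by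
    induction l with
    | nil =>
      obtain ⟨c, hc⟩ := toral_smul_vac (ε := ε) hD hχ hx
      simp only [List.map_nil, List.prod_nil, one_smul, hc]
      exact Submodule.smul_mem _ _ (by simpa using lowerSpan_word (D := D) (χ := χ) (ε := ε) [])
    | cons j l ih =>
      obtain ⟨c, hc⟩ := hD.toral_mul_f x hx j
      rw [List.map_cons, List.prod_cons, mul_smul, ← mul_smul x, hc, smul_assoc, mul_smul]
      exact Submodule.smul_mem _ _ (lowerSpan_f j _ ih)

theorem lowerSpan_e (hD : D.IsTriangular k hinv) (hχ : ∀ i, χ i ≠ 0) (i : J) :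
    ∀ w ∈ lowerSpan D χ ε, D.e i • w ∈ lowerSpan D χ ε :=
  lowerSpan_stable fun l => by
    induction l with
    | nil => simp [e_smul_vac]
    | cons j l ih =>
      obtain ⟨c, u, hu, h⟩ := hD.e_mul_f i j
      rw [List.map_cons, List.prod_cons, mul_smul, ← mul_smul (D.e i), h, add_smul, smul_assoc,
        mul_smul]
      exact Submodule.add_mem _ (Submodule.smul_mem _ _ (lowerSpan_f j _ ih))
        (smul_mem_of_mem_adjoin (fun x hx => lowerSpan_toral hD hχ hx) hu _ (lowerSpan_word l))

theorem lowerSpan_eq_top (hD : D.IsTriangular k hinv) (hχ : ∀ i, χ i ≠ 0) :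
    lowerSpan D χ ε = ⊤ := by
  rw [eq_top_iff]
  rintro x -
  obtain ⟨a, rfl⟩ := Submodule.Quotient.mk_surjective _ x
  rw [← smul_vac]
  refine smul_mem_of_mem_adjoin (k := k) (S := Set.range D.e ∪ Set.range D.f ∪ D.toral hinv) ?_
    (hD.adjoin_eq_top ▸ Algebra.mem_top) _
    (by simpa using lowerSpan_word (D := D) (χ := χ) (ε := ε) [])
  rintro _ ((⟨j, rfl⟩ | ⟨j, rfl⟩) | hx)
  · exact lowerSpan_e hD hχ j
  · exact lowerSpan_f j
  · exact lowerSpan_toral hD hχ hx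

/-- The Verma module `M` with generator `v` is `k v + ∑_j f_j M`. -/
theorem verma_decomp (hD : D.IsTriangular k hinv) (hχ : ∀ i, χ i ≠ 0) (x : Verma D χ ε) :
    ∃ c : k, ∃ y ∈ AddSubgroup.closure {y | ∃ j, ∃ z : Verma D χ ε, y = D.f j • z},
      x = c • vac D χ ε + y := by
  have hx : x ∈ lowerSpan D χ ε := lowerSpan_eq_top hD hχ ▸ Submodule.mem_top
  induction hx using Submodule.span_induction with
  | zero => exact ⟨0, 0, AddSubgroup.zero_mem _, by simp⟩
  | add x y _ _ hx hy =>
    obtain ⟨c, x', hx', rfl⟩ := hx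
    obtain ⟨d, y', hy', rfl⟩ := hy
    exact ⟨c + d, x' + y', AddSubgroup.add_mem _ hx' hy', by rw [add_smul]; abel⟩
  | smul c x hmem hx =>
    clear hmem
    obtain ⟨d, x', hx', rfl⟩ := hx
    refine ⟨c * d, c • x', ?_, by rw [smul_add, smul_smul]⟩
    induction hx' using AddSubgroup.closure_induction with
    | mem y hy =>
      obtain ⟨j, z, rfl⟩ := hy
      exact AddSubgroup.subset_closure ⟨j, c • z, smul_comm _ _ _⟩
    | zero => rw [smul_zero]; exact AddSubgroup.zero_mem _
    | add y z _ _ hy hz => rw [smul_add]; exact AddSubgroup.add_mem _ hy hz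
    | neg y _ hy => rw [smul_neg]; exact AddSubgroup.neg_mem _ hy
  | mem x hx =>
    obtain ⟨l, rfl⟩ := hx
    cases l with
    | nil => exact ⟨1, 0, AddSubgroup.zero_mem _, by simp⟩
    | cons j l =>
      refine ⟨0, _, AddSubgroup.subset_closure ⟨j, (l.map D.f).prod • vac D χ ε, rfl⟩, ?_⟩
      simp [mul_smul]

/-- A simple module with a highest weight vector `v` is `V(χ)` as soon as some linear functional
separates `v` from the vectors `f j • p`. -/
theorem nonempty_equiv_simpleHW (hD : D.IsTriangular k hinv) (hχ : ∀ i, χ i ≠ 0) {Q : Type*}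
    [AddCommGroup Q] [Module k Q] [Module A Q] [IsScalarTower k A Q] [IsSimpleModule A Q] (v : Q)
    (raise : ∀ j, D.e j • v = 0) (weight : ∀ i, D.h i • v = χ i • v) (parity : D.s • v = ε • v)
    (θ : Q →ₗ[k] k) (hv : θ v ≠ 0) (hf : ∀ j p, θ (D.f j • p) = 0) :
    Nonempty (Q ≃ₗ[A] SimpleHW D χ ε) := by
  have hle : vermaIdeal D χ ε ≤ LinearMap.ker (LinearMap.toSpanSingleton A Q v) := by
    refine Submodule.span_le.2 ?_
    rintro _ ((⟨j, rfl⟩ | ⟨i, rfl⟩) | rfl)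
    · simpa using raise j
    · simp [sub_smul, weight]
    · simp [sub_smul, parity]
  let ψ : Verma D χ ε →ₗ[A] Q := Submodule.liftQ _ _ hle
  have hψ : ψ (vac D χ ε) = v := by simp [ψ, vac]
  have hψk : ∀ (c : k) (x : Verma D χ ε), ψ (c • x) = c • ψ x := fun c x => by
    rw [← algebraMap_smul A c x, map_smul, algebraMap_smul]
  have hv0 : v ≠ 0 := fun h => hv (by rw [h, map_zero])
  have hθ : ∀ y ∈ AddSubgroup.closure {y | ∃ j, ∃ z : Verma D χ ε, y = D.f j • z},
      θ (ψ y) = 0 := by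
    intro y hy
    induction hy using AddSubgroup.closure_induction with
    | mem y hy => obtain ⟨j, z, rfl⟩ := hy; rw [map_smul, hf]
    | zero => simp
    | add y z _ _ hy hz => rw [map_add, map_add, hy, hz, add_zero]
    | neg y _ hy => rw [map_neg, map_neg, hy, neg_zero]
  have hker : LinearMap.ker ψ = vermaRadical D χ ε := by
    apply le_antisymm
    · refine le_sSup fun x hx => ?_
      obtain ⟨c, y, hy, rfl⟩ := verma_decomp hD hχ x
      have h : θ (ψ (c • vac D χ ε + y)) = 0 := by rw [LinearMap.mem_ker.1 hx, map_zero]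
      rw [map_add, map_add, hθ y hy, add_zero, hψk, hψ, map_smul, smul_eq_mul] at h
      rw [(mul_eq_zero.1 h).resolve_right hv, zero_smul, zero_add]
      exact hy
    · refine sSup_le fun N hN => ?_
      rw [LinearMap.le_ker_iff_map]
      refine (eq_bot_or_eq_top (N.map ψ)).resolve_right fun htop => ?_
      obtain ⟨x, hx, hxv⟩ : v ∈ N.map ψ := htop ▸ Submodule.mem_top
      exact hv (hxv ▸ hθ x (hN x hx))
  have hsurj : Function.Surjective ψ := by
    rw [← LinearMap.range_eq_top]
    refine (eq_bot_or_eq_top _).resolve_left fun h => hv0 ?_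
    have : v ∈ LinearMap.range ψ := ⟨_, hψ⟩
    simpa [h] using this
  exact ⟨((Submodule.quotEquivOfEq _ _ hker.symm).trans
    (LinearMap.quotKerEquivOfSurjective ψ hsurj)).symm⟩

end verma

/-! ### Modules with a monomial basis -/

/-- A basis of a module permuted by the generators up to scalars: `e j` is injective on the basis
vectors that it does not kill, with inverse a multiple of `f j`, and it decreases a height, while
`f j` increases it; exactly one basis vector is killed by all `e j`. -/
structure IsMonomial {Q B : Type*} [AddCommGroup Q] [Module k Q] [Module A Q]
    (D : GenSystem A J H) (b : Module.Basis B k Q) (ht : B → ℕ) (top : B) : Prop where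
  e_smul : ∀ j x, D.e j • b x = 0 ∨ ∃ y, ∃ c d : k, c ≠ 0 ∧ d ≠ 0 ∧ ht y < ht x ∧
    D.e j • b x = c • b y ∧ D.f j • b y = d • b x
  f_smul : ∀ j x, D.f j • b x = 0 ∨ ∃ y, ∃ c : k, ht x < ht y ∧ D.f j • b x = c • b y
  e_top : ∀ j, D.e j • b top = 0
  eq_top : ∀ x, (∀ j, D.e j • b x = 0) → x = top

namespace IsMonomial

variable {Q B : Type*} [AddCommGroup Q] [Module k Q] [Module A Q] [IsScalarTower k A Q]
  {D : GenSystem A J H} {b : Module.Basis B k Q} {ht : B → ℕ} {top : B}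

theorem e_smul_eq (j : J) (w : Q) :
    D.e j • w = ∑ x ∈ (b.repr w).support, b.repr w x • (D.e j • b x) := by
  conv_lhs => rw [← b.linearCombination_repr w]
  rw [Finsupp.linearCombination_apply, Finsupp.sum, Finset.smul_sum]
  exact Finset.sum_congr rfl fun x _ => smul_comm _ _ _

theorem f_smul_eq (j : J) (w : Q) :
    D.f j • w = ∑ x ∈ (b.repr w).support, b.repr w x • (D.f j • b x) := by
  conv_lhs => rw [← b.linearCombination_repr w]
  rw [Finsupp.linearCombination_apply, Finsupp.sum, Finset.smul_sum]
  exact Finset.sum_congr rfl fun x _ => smul_comm _ _ _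

/-- A vector is killed by `e j` only if all basis vectors that occur in it are. -/
theorem e_smul_basis_eq_zero (hb : IsMonomial D b ht top) {j : J} {w : Q} (hw : D.e j • w = 0)
    {x : B} (hx : b.repr w x ≠ 0) : D.e j • b x = 0 := by
  refine (hb.e_smul j x).resolve_right ?_
  rintro ⟨y, c, d, hc, hd, -, he, hf⟩
  have h := congrArg (fun w => b.repr w y) (e_smul_eq (D := D) (b := b) j w)
  simp only [hw, map_zero, Finsupp.coe_zero, Pi.zero_apply, map_sum, map_smul] at h
  rw [Finsupp.finsetSum_apply, Finset.sum_eq_single x] at h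
  · rw [he] at h
    simp only [map_smul, Finsupp.smul_apply, b.repr_self, Finsupp.single_eq_same, smul_eq_mul,
      mul_one] at h
    exact (mul_ne_zero hx hc) h.symm
  · intro z _ hz
    rcases hb.e_smul j z with h0 | ⟨y', c', d', hc', hd', -, he', hf'⟩
    · simp [h0]
    · by_cases hy : y' = y
      · subst hy
        exfalso
        -- `f j` sends `b y'` to nonzero multiples of both `b x` and `b z`
        have h2 := congrArg (fun w => b.repr w z) (hf.symm.trans hf')
        simp [Finsupp.single_eq_of_ne hz] at h2
        exact hd' h2.symm
      · rw [he']
        simp [Finsupp.single_eq_of_ne (Ne.symm hy)]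
  · intro h0
    exact absurd (Finsupp.mem_support_iff.2 hx) h0

/-- Raising as long as possible shows that every nonzero submodule contains the top vector. -/
theorem top_mem (hb : IsMonomial D b ht top) (N : Submodule A Q) :
    ∀ (r : ℕ) (w : Q), w ∈ N → w ≠ 0 → (∀ x, b.repr w x ≠ 0 → ht x < r) → b top ∈ N := by
  intro r
  induction r with
  | zero =>
    intro w _ hw0 hr
    exfalso
    apply hw0
    apply b.repr.injective
    ext x
    by_contra hx
    exact absurd (hr x (by simpa using hx)) (Nat.not_lt_zero _)
  | succ r ih =>
    intro w hw hw0 hr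
    by_cases hall : ∀ j, D.e j • w = 0
    · have hsupp : ∀ x, b.repr w x ≠ 0 → x = top := fun x hx =>
        hb.eq_top x fun j => hb.e_smul_basis_eq_zero (hall j) hx
      have hw' : w = b.repr w top • b top := by
        apply b.repr.injective
        ext x
        by_cases hx : x = top
        · subst hx; simp
        · have : b.repr w x = 0 := by
            by_contra h0; exact hx (hsupp x h0)
          simp [this, Finsupp.single_eq_of_ne hx]
      have hc : b.repr w top ≠ 0 := fun h => hw0 (by rw [hw', h, zero_smul])
      have : b top = (b.repr w top)⁻¹ • w := by
        nth_rewrite 2 [hw']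
        rw [smul_smul, inv_mul_cancel₀ hc, one_smul]
      rw [this, ← algebraMap_smul A]
      exact N.smul_mem _ hw
    · push Not at hall
      obtain ⟨j, hj⟩ := hall
      refine ih (D.e j • w) (N.smul_mem _ hw) hj fun y hy => ?_
      rw [e_smul_eq (b := b), map_sum, Finsupp.finsetSum_apply] at hy
      obtain ⟨x, hx, hxy⟩ := Finset.exists_ne_zero_of_sum_ne_zero hy
      rcases hb.e_smul j x with h0 | ⟨y', c, d, -, -, hlt, he, -⟩
      · simp [h0] at hxy
      · have : y = y' := by
          by_contra hne
          simp [he, Finsupp.single_eq_of_ne hne] at hxy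
        subst this
        have := hr x (Finsupp.mem_support_iff.1 hx)
        omega

/-- Every basis vector is obtained from the top one by lowering. -/
theorem basis_mem (hb : IsMonomial D b ht top) {N : Submodule A Q} (hN : b top ∈ N) (x : B) :
    b x ∈ N := by
  induction hr : ht x using Nat.strong_induction_on generalizing x with
  | _ r ih =>
    by_cases hall : ∀ j, D.e j • b x = 0
    · rwa [hb.eq_top x hall]
    · push Not at hall
      obtain ⟨j, hj⟩ := hall
      obtain ⟨y, c, d, -, hd, hlt, -, hf⟩ := (hb.e_smul j x).resolve_left hj
      have : b x = d⁻¹ • (D.f j • b y) := by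
        rw [hf, smul_smul, inv_mul_cancel₀ hd, one_smul]
      rw [this, ← algebraMap_smul A]
      exact N.smul_mem _ (N.smul_mem _ (ih _ (hr ▸ hlt) y rfl))

theorem eq_top_of_mem (hb : IsMonomial D b ht top) {N : Submodule A Q} (hN : b top ∈ N) :
    N = ⊤ := by
  rw [eq_top_iff]
  rintro w -
  rw [← b.linearCombination_repr w, Finsupp.linearCombination_apply, Finsupp.sum]
  refine N.sum_mem fun x _ => ?_
  rw [← algebraMap_smul A]
  exact N.smul_mem _ (hb.basis_mem hN x)

theorem isSimpleModule (hb : IsMonomial D b ht top) : IsSimpleModule A Q := by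
  rw [isSimpleModule_iff]
  have : Nontrivial Q := ⟨b top, 0, b.ne_zero top⟩
  refine { eq_bot_or_eq_top := fun N => or_iff_not_imp_left.2 fun hN => ?_ }
  obtain ⟨w, hw, hw0⟩ := (Submodule.ne_bot_iff N).1 hN
  refine hb.eq_top_of_mem (hb.top_mem N (((b.repr w).support.sup ht) + 1) w hw hw0 fun x hx => ?_)
  exact Nat.lt_succ_of_le (Finset.le_sup (f := ht) (Finsupp.mem_support_iff.2 hx))

theorem f_smul_coord (hb : IsMonomial D b ht top) (j : J) (w : Q) :
    b.coord top (D.f j • w) = 0 := by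
  rw [f_smul_eq (b := b), map_sum]
  refine Finset.sum_eq_zero fun x _ => ?_
  rcases hb.f_smul j x with h0 | ⟨y, c, hlt, hf⟩
  · simp [h0]
  · have hy : top ≠ y := by
      rintro rfl
      -- lowering never ends at the vector of least height
      have hmin : ∀ (r : ℕ) (x : B), ht x = r → ht top ≤ r := by
        intro r
        induction r using Nat.strong_induction_on with
        | _ r ih =>
          intro x hx
          by_cases hall : ∀ j, D.e j • b x = 0
          · rw [hb.eq_top x hall] at hx; exact hx.le
          · push Not at hall
            obtain ⟨j, hj⟩ := hall
            obtain ⟨y, c, d, -, -, hlt, -, -⟩ := (hb.e_smul j x).resolve_left hj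
            exact (ih (ht y) (hx ▸ hlt) y rfl).trans (hx ▸ hlt.le)
      exact absurd (hmin _ x rfl) (by omega)
    simp [hf, Finsupp.single_eq_of_ne hy]

end IsMonomial

/-- A submodule with a monomial basis is simple, and it is the irreducible highest weight module of
the weight of its top vector. -/
theorem isSimpleHighestWeight_of_isMonomial {D : GenSystem A J H} {hinv : H → A}
    (hD : D.IsTriangular k hinv) {χ : H → k} (hχ : ∀ i, χ i ≠ 0) {ε : k}
    {W : Type*} [AddCommGroup W] [Module k W] [Module A W] [IsScalarTower k A W]
    {P : Submodule A W} {B : Type*} {b : Module.Basis B k P} {ht : B → ℕ} {top : B}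
    (hb : IsMonomial D b ht top) (weight : ∀ i, D.h i • (b top : W) = χ i • (b top : W))
    (parity : D.s • (b top : W) = ε • (b top : W)) :
    IsSimpleHighestWeight D χ ε P (b top : W) where
  simple := hb.isSimpleModule
  ne_zero h := b.ne_zero top (Subtype.ext h)
  raise j := by
    have := congrArg Subtype.val (hb.e_top j)
    simpa using this
  weight := weight
  parity := parity
  generates := by
    apply le_antisymm
    · rw [Submodule.span_singleton_le_iff_mem]
      exact (b top).2
    · have h := hb.eq_top_of_mem (Submodule.mem_span_singleton_self (R := A) (b top))
      have h2 := congrArg (Submodule.map P.subtype) h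
      rw [Submodule.map_span, Set.image_singleton, Submodule.map_top, Submodule.range_subtype] at h2
      exact h2.ge
  iso := by
    have := hb.isSimpleModule
    exact nonempty_equiv_simpleHW hD hχ (b top) hb.e_top
      (fun i => Subtype.ext (by simpa using weight i)) (Subtype.ext (by simpa using parity))
      (b.coord top) (by simp) hb.f_smul_coord

end highest_weight

/-! ### The monomials of `Ω_q^!` and the raising and lowering operators -/

section monomials

variable {m n : ℕ}

/-- The largest exponent at position `i`: `1` in the even positions and `L - 1` in the odd ones. -/
def capExp (m n L : ℕ) (i : Fin (m + n)) : ℕ := if (i : ℕ) < m then 1 else L - 1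

/-- The exponents of the monomials of degree `t` all of whose odd exponents are less than `L`. -/
structure Allowed (L t : ℕ) (β : Fin (m + n) → ℕ) : Prop where
  le_cap : ∀ i, β i ≤ capExp m n L i
  sum_eq : ∑ i, β i = t

/-- The exponents filled up from the left: a position is occupied only if its left neighbour is
full. -/
def IsGreedy (L : ℕ) (β : Fin (m + n) → ℕ) : Prop :=
  ∀ j : Fin (m + n - 1), β (hi j) = 0 ∨ β (lo j) = capExp m n L (lo j)

theorem Allowed.even_le {L t : ℕ} {β : Fin (m + n) → ℕ} (h : Allowed L t β) (i : Fin (m + n))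
    (hi : (i : ℕ) < m) : β i ≤ 1 := by
  simpa [capExp, hi] using h.le_cap i

theorem capExp_pos {L : ℕ} (hL : 2 ≤ L) (i : Fin (m + n)) : 0 < capExp m n L i := by
  unfold capExp
  split_ifs <;> omega

theorem IsGreedy.eq_zero_of_lt {L : ℕ} (hL : 2 ≤ L) {β : Fin (m + n) → ℕ} (hβ : IsGreedy L β)
    {p : Fin (m + n)} (hp : β p < capExp m n L p) (i : Fin (m + n)) (hi : p < i) : β i = 0 := by
  obtain ⟨i, hi'⟩ := i
  induction i with
  | zero => exact absurd hi (by simp [Fin.lt_def])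
  | succ i ih =>
    have hlt : β ⟨i, by omega⟩ < capExp m n L ⟨i, by omega⟩ := by
      rcases Nat.lt_or_ge (p : ℕ) i with h | h
      · rw [ih (by omega) h]
        exact capExp_pos hL _
      · have : p = ⟨i, by omega⟩ := by
          apply Fin.ext
          have : (p : ℕ) < i + 1 := hi
          simp only; omega
        rwa [← this]
    rcases hβ ⟨i, by omega⟩ with h | h
    · exact h
    · exact absurd h (ne_of_lt hlt)

/-- There is at most one greedy exponent of each degree. -/
theorem IsGreedy.unique {L t : ℕ} (hL : 2 ≤ L) {β γ : Fin (m + n) → ℕ} (hβ : IsGreedy L β)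
    (hβ' : Allowed L t β) (hγ : IsGreedy L γ) (hγ' : Allowed L t γ) : β = γ := by
  -- At the first difference the smaller exponent is not full, hence it vanishes further on.
  have key : ∀ {β γ : Fin (m + n) → ℕ} {p : Fin (m + n)}, IsGreedy L β → Allowed L t β →
      Allowed L t γ → (∀ i < p, β i = γ i) → ¬ β p < γ p := by
    intro β γ p hβ hβ' hγ' hlt hp
    have hz := hβ.eq_zero_of_lt hL (lt_of_lt_of_le hp (hγ'.le_cap p))
    have : ∑ i, β i < ∑ i, γ i := by
      refine Finset.sum_lt_sum (fun i _ => ?_) ⟨p, Finset.mem_univ _, hp⟩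
      rcases lt_trichotomy i p with h | rfl | h
      · exact (hlt i h).le
      · exact hp.le
      · rw [hz i h]; exact Nat.zero_le _
    rw [hβ'.sum_eq, hγ'.sum_eq] at this
    exact lt_irrefl _ this
  funext p
  induction p using WellFoundedLT.induction with
  | _ p ih =>
    exact le_antisymm (not_lt.1 (key hγ hγ' hβ' fun i hi => (ih i hi).symm))
      (not_lt.1 (key hβ hβ' hγ' ih))

/-- The exponent `β` with one unit moved from position `b` to position `a`. -/
def shift (a b : Fin (m + n)) (β : Fin (m + n) → ℕ) : Fin (m + n) → ℕ :=
  Function.update (Function.update β b (β b - 1)) a (β a + 1)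

theorem shift_add {a b : Fin (m + n)} (hab : a ≠ b) {β : Fin (m + n) → ℕ} (hb : 0 < β b) :
    shift a b β + Pi.single b 1 = β + Pi.single a 1 := by
  funext i
  simp only [shift, Pi.add_apply]
  by_cases hia : i = a
  · subst hia; simp [hab]
  · by_cases hib : i = b
    · subst hib; simp [hia]; omega
    · simp [hia, hib]

theorem shift_shift {a b : Fin (m + n)} (hab : a ≠ b) {β : Fin (m + n) → ℕ} (hb : 0 < β b) :
    shift b a (shift a b β) = β := by
  have h : 0 < shift a b β a := by simp [shift]
  have h2 := shift_add hab.symm h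
  rw [shift_add hab hb] at h2
  exact add_right_cancel h2

/-- The height of an exponent, which decreases when units move to the left. -/
def expHeight (β : Fin (m + n) → ℕ) : ℕ := ∑ i : Fin (m + n), (i : ℕ) * β i

theorem expHeight_shift {a b : Fin (m + n)} (hab : a ≠ b) {β : Fin (m + n) → ℕ} (hb : 0 < β b) :
    expHeight (shift a b β) + b = expHeight β + a := by
  have h : ∀ (c : Fin (m + n)) (γ : Fin (m + n) → ℕ),
      expHeight (γ + Pi.single c 1) = expHeight γ + c := by
    intro c γ
    simp [expHeight, mul_add, Finset.sum_add_distrib, Pi.single_apply]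
  rw [← h, ← h, shift_add hab hb]

theorem Allowed.shift {L t : ℕ} {a b : Fin (m + n)} (hab : a ≠ b) {β : Fin (m + n) → ℕ}
    (hβ : Allowed L t β) (hb : 0 < β b) (ha : β a < capExp m n L a) :
    Allowed L t (shift a b β) where
  le_cap i := by
    have h := congrFun (shift_add hab hb) i
    simp only [Pi.add_apply, Pi.single_apply] at h
    have := hβ.le_cap i
    by_cases hia : i = a
    · subst hia
      rw [if_pos rfl, if_neg hab] at h
      omega
    · rw [if_neg hia] at h
      omega
  sum_eq := by
    have h := congrArg (fun γ => ∑ i, γ i) (shift_add hab hb)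
    simp only [Pi.add_apply, Finset.sum_add_distrib, Finset.sum_pi_single', Finset.mem_univ,
      if_true, hβ.sum_eq] at h
    simpa [hβ.sum_eq] using h

end monomials

section operators

variable {k : Type*} [Field k] (q : kˣ) {m n : ℕ}

/-- The bound `L` on the odd exponents is respected by raising and lowering in degree `t`, either
because `[L] = 0` or because the degree is too small for it to matter. -/
structure IsCutoff (L t : ℕ) : Prop where
  two_le : 2 ≤ L
  wall : qnum q L = 0 ∨ t < L

variable {q} {L t : ℕ}

theorem opU_mul_opL_mono {a b : Fin (m + n)} (hab : a ≠ b) (β : Fin (m + n) → ℕ) :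
    (opU q a * opL k b) (mono k β) = (dnC k b (β b) * upC q a (β a)) • mono k (shift a b β) := by
  rw [Module.End.mul_apply, opL_mono, map_smul, opU_mono, Function.update_of_ne hab, smul_smul]
  rfl

/-- Off the walls, `x_a ∂_b` moves one unit from position `b` to position `a`. -/
theorem opU_mul_opL_mono_of_lt {a b : Fin (m + n)} (hab : a ≠ b) {β : Fin (m + n) → ℕ}
    (hβ : Allowed L t β) (hb : 0 < β b) :
    (opU q a * opL k b) (mono k β) = upC q a (β a) • mono k (shift a b β) := by
  rw [opU_mul_opL_mono hab]
  have : dnC k b (β b) = 1 := by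
    unfold dnC
    split_ifs with h1 h2 h3
    · rfl
    · have := hβ.even_le b h1; omega
    · omega
    · rfl
  rw [this, one_mul]

theorem opU_mul_opL_mono_eq_zero (hL : IsCutoff q L t) {a b : Fin (m + n)} (hab : a ≠ b)
    {β : Fin (m + n) → ℕ} (hβ : Allowed L t β) (h : β b = 0 ∨ β a = capExp m n L a) :
    (opU q a * opL k b) (mono k β) = 0 := by
  rcases Nat.eq_zero_or_pos (β b) with hb | hb
  · rw [opU_mul_opL_mono hab, hb]
    simp [dnC]
  · have ha := h.resolve_left hb.ne'
    rw [opU_mul_opL_mono_of_lt hab hβ hb]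
    have : upC q a (β a) = 0 := by
      rw [ha]
      by_cases h1 : (a : ℕ) < m
      · simp [upC, capExp, h1]
      · have h2 := hL.two_le
        simp only [upC, capExp, if_neg h1]
        rw [show L - 1 + 1 = L by omega]
        refine hL.wall.resolve_right fun hlt => ?_
        have h3 : β a + β b ≤ ∑ i, β i := by
          rw [← Finset.sum_pair hab]
          exact Finset.sum_le_sum_of_subset (Finset.subset_univ _)
        rw [hβ.sum_eq, ha] at h3
        simp only [capExp, if_neg h1] at h3
        omega
    rw [this, zero_smul]

theorem upC_ne_zero (hne : ∀ r, 0 < r → r < L → qnum q r ≠ 0) {a : Fin (m + n)} {r : ℕ}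
    (hr : r < capExp m n L a) : upC q a r ≠ 0 := by
  unfold upC capExp at *
  split_ifs at * with h1 h2
  · exact one_ne_zero
  · omega
  · exact hne _ (by omega) (by omega)

/-- The span of the monomials of degree `t` all of whose odd exponents are less than `L`. -/
def allowedSpan (k : Type*) [Field k] (m n L t : ℕ) : Submodule k (Omega k m n) :=
  Submodule.span k {w | ∃ β : Fin (m + n) → ℕ, Allowed L t β ∧ w = mono k β}

theorem mono_mem_allowedSpan {β : Fin (m + n) → ℕ} (hβ : Allowed L t β) :
    mono k β ∈ allowedSpan k m n L t :=
  Submodule.subset_span ⟨β, hβ, rfl⟩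

theorem allowedSpan_stable {f : Module.End k (Omega k m n)}
    (hf : ∀ β, Allowed L t β → f (mono k β) ∈ allowedSpan k m n L t) :
    ∀ w ∈ allowedSpan k m n L t, f w ∈ allowedSpan k m n L t := by
  intro w hw
  refine (Submodule.span_le (p := (allowedSpan k m n L t).comap f)).2 ?_ hw
  rintro _ ⟨β, hβ, rfl⟩
  exact hf β hβ

theorem genAct_allowedSpan (hL : IsCutoff q L t) (g : Gen m n) :
    ∀ w ∈ allowedSpan k m n L t, genAct q g w ∈ allowedSpan k m n L t := by
  refine allowedSpan_stable fun β hβ => ?_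
  have key : ∀ a b : Fin (m + n), a ≠ b →
      (opU q a * opL k b) (mono k β) ∈ allowedSpan k m n L t := by
    intro a b hab
    by_cases h : β b = 0 ∨ β a = capExp m n L a
    · rw [opU_mul_opL_mono_eq_zero hL hab hβ h]
      exact Submodule.zero_mem _
    · push Not at h
      have hb : 0 < β b := Nat.pos_of_ne_zero h.1
      rw [opU_mul_opL_mono_of_lt hab hβ hb]
      exact Submodule.smul_mem _ _ (mono_mem_allowedSpan
        (hβ.shift hab hb (lt_of_le_of_ne (hβ.le_cap a) h.2)))
  cases g with
  | E j => rw [genAct_E]; exact key _ _ (lo_ne_hi j)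
  | F j => rw [genAct_F]; exact key _ _ (lo_ne_hi j).symm
  | K i => rw [genAct, opSigma_mono]; exact Submodule.smul_mem _ _ (mono_mem_allowedSpan hβ)
  | Kinv i => rw [genAct, opSigmaInv_mono]; exact Submodule.smul_mem _ _ (mono_mem_allowedSpan hβ)
  | sigma => rw [genAct, opParity_mono]; exact Submodule.smul_mem _ _ (mono_mem_allowedSpan hβ)

theorem omegaHom_eq_allowedSpan : omegaHom k m n t = allowedSpan k m n (t + 2) t := by
  apply le_antisymm
  · refine Submodule.span_le.2 ?_
    rintro _ ⟨β, hβ, rfl⟩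
    refine mono_ind (P := fun w => w ∈ (allowedSpan k m n (t + 2) t : Set (Omega k m n))) β
      (Submodule.zero_mem _) fun h => mono_mem_allowedSpan ⟨fun i => ?_, hβ⟩
    unfold capExp
    split_ifs with hi
    · exact h i hi
    · have := Finset.single_le_sum (f := β) (fun i _ => Nat.zero_le _) (Finset.mem_univ i)
      omega
  · refine Submodule.span_le.2 ?_
    rintro _ ⟨β, hβ, rfl⟩
    exact Submodule.subset_span ⟨β, hβ.sum_eq, rfl⟩

theorem linearIndependent_mono :
    LinearIndependent k fun β : {β : Fin (m + n) → ℕ // Allowed L t β} => mono k β.1 := by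
  have h := (Finsupp.linearIndependent_single_one k (Expo m n)).comp
    (fun β : {β : Fin (m + n) → ℕ // Allowed L t β} => (⟨β.1, β.2.even_le⟩ : Expo m n))
    (fun β γ h => Subtype.ext (congrArg (fun b : Expo m n => b.1) h))
  convert h using 1
  funext β
  simp only [mono, Function.comp_apply]
  rw [dif_pos β.2.even_le]

/-- A homogeneous component of a space of monomials, all of whose monomials are linked by raising
and lowering, is the irreducible highest weight module of the weight of its greedy monomial. Here
`ι` identifies the module with a space spanned by monomials. -/
theorem isSimpleHighestWeight_of_greedy {A H : Type*} [Ring A] [Algebra k A]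
    {D : GenSystem A (Fin (m + n - 1)) H} {hinv : H → A} (hD : D.IsTriangular k hinv)
    {χ : H → k} (hχ : ∀ i, χ i ≠ 0) {ε : k}
    {W : Type*} [AddCommGroup W] [Module k W] [Module A W] [IsScalarTower k A W]
    {ι : W →ₗ[k] Omega k m n} (hι : Function.Injective ι)
    (he : ∀ j w, ι (D.e j • w) = genAct q (.E j) (ι w))
    (hf : ∀ j w, ι (D.f j • w) = genAct q (.F j) (ι w))
    (hrange : ∀ β, Allowed L t β → ∃ w, ι w = mono k β)
    (hL : IsCutoff q L t) (hne : ∀ r, 0 < r → r < L → qnum q r ≠ 0)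
    {P : Submodule A W} (hP : ∀ w, w ∈ P ↔ ι w ∈ allowedSpan k m n L t)
    {v : W} {γ : Fin (m + n) → ℕ} (hv : ι v = mono k γ) (hγ : Allowed L t γ) (hg : IsGreedy L γ)
    (weight : ∀ i, D.h i • v = χ i • v) (parity : D.s • v = ε • v) :
    IsSimpleHighestWeight D χ ε P v := by
  have hmem : ∀ β : {β : Fin (m + n) → ℕ // Allowed L t β}, ∃ w : P, ι w = mono k β.1 := by
    intro β
    obtain ⟨w, hw⟩ := hrange β.1 β.2
    exact ⟨⟨w, (hP w).2 (hw ▸ mono_mem_allowedSpan β.2)⟩, hw⟩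
  choose u hu using hmem
  let ιP : P →ₗ[k] Omega k m n := ι ∘ₗ (P.subtype.restrictScalars k)
  have hιP : Function.Injective ιP := hι.comp Subtype.val_injective
  have hui : ∀ β, ιP (u β) = mono k β.1 := hu
  have hli : LinearIndependent k u := by
    apply LinearIndependent.of_comp ιP
    convert linearIndependent_mono (k := k) (L := L) (t := t) using 1
    funext β
    exact hui β
  have hspan : ⊤ ≤ Submodule.span k (Set.range u) := by
    rintro w -
    have hw : ιP w ∈ allowedSpan k m n L t := (hP w).1 w.2
    have hle : allowedSpan k m n L t ≤ (Submodule.span k (Set.range u)).map ιP := by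
      refine Submodule.span_le.2 ?_
      rintro _ ⟨β, hβ, rfl⟩
      exact ⟨u ⟨β, hβ⟩, Submodule.subset_span ⟨_, rfl⟩, hui _⟩
    obtain ⟨w', hw', h⟩ := hle hw
    exact hιP h ▸ hw'
  let b : Module.Basis {β : Fin (m + n) → ℕ // Allowed L t β} k P := Module.Basis.mk hli hspan
  have hb : ∀ β, ιP (b β) = mono k β.1 := fun β => by rw [Module.Basis.mk_apply, hui]
  have heP : ∀ j w, ιP (D.e j • w) = (opU q (lo j) * opL k (hi j)) (ιP w) := fun j w => by
    rw [← genAct_E]; exact he j w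
  have hfP : ∀ j w, ιP (D.f j • w) = (opU q (hi j) * opL k (lo j)) (ιP w) := fun j w => by
    rw [← genAct_F]; exact hf j w
  have hv' : v = (b ⟨γ, hγ⟩ : W) := hι (hv.trans (hb ⟨γ, hγ⟩).symm)
  have hlo : ∀ j : Fin (m + n - 1), (lo j : ℕ) = j := fun _ => rfl
  have hhi : ∀ j : Fin (m + n - 1), (hi j : ℕ) = j + 1 := fun _ => rfl
  -- `e j` and `f j` act on the basis as `x_a ∂_b` for neighbouring positions `a`, `b`
  have move : ∀ (a b' : Fin (m + n)), a ≠ b' → ∀ x : {β : Fin (m + n) → ℕ // Allowed L t β},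
      x.1 b' ≠ 0 → x.1 a ≠ capExp m n L a → ∃ y : {β : Fin (m + n) → ℕ // Allowed L t β},
        ∃ c d : k, c ≠ 0 ∧ d ≠ 0 ∧ expHeight y.1 + b' = expHeight x.1 + a ∧
          (opU q a * opL k b') (ιP (b x)) = c • ιP (b y) ∧
          (opU q b' * opL k a) (ιP (b y)) = d • ιP (b x) := by
    intro a b' hab x h1 h2
    have hb0 : 0 < x.1 b' := Nat.pos_of_ne_zero h1
    have ha0 : x.1 a < capExp m n L a := lt_of_le_of_ne (x.2.le_cap a) h2
    have hy := x.2.shift hab hb0 ha0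
    have hya : 0 < shift a b' x.1 a := by simp [shift]
    refine ⟨⟨shift a b' x.1, hy⟩, upC q a (x.1 a), upC q b' (shift a b' x.1 b'),
      upC_ne_zero hne ha0, upC_ne_zero hne ?_, expHeight_shift hab hb0, ?_, ?_⟩
    · have := x.2.le_cap b'
      simp only [shift, Function.update_of_ne hab.symm, Function.update_self]
      omega
    · rw [hb, hb, opU_mul_opL_mono_of_lt hab x.2 hb0]
    · rw [hb, hb, opU_mul_opL_mono_of_lt hab.symm hy hya, shift_shift hab hb0]
  have hmono : IsMonomial D b (fun β => expHeight β.1) ⟨γ, hγ⟩ := by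
    refine ⟨fun j x => ?_, fun j x => ?_, fun j => ?_, fun x hx => ?_⟩
    · refine or_iff_not_imp_left.2 fun h0 => ?_
      have h0' : ¬ (x.1 (hi j) = 0 ∨ x.1 (lo j) = capExp m n L (lo j)) := fun h => h0 <| hιP <| by
        rw [heP, hb, opU_mul_opL_mono_eq_zero hL (lo_ne_hi j) x.2 h, map_zero]
      push Not at h0'
      obtain ⟨y, c, d, hc, hd, hh, h1, h2⟩ := move _ _ (lo_ne_hi j) x h0'.1 h0'.2
      rw [hlo, hhi] at hh
      exact ⟨y, c, d, hc, hd, by omega, hιP (by rw [heP, h1, map_smul]),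
        hιP (by rw [hfP, h2, map_smul])⟩
    · refine or_iff_not_imp_left.2 fun h0 => ?_
      have h0' : ¬ (x.1 (lo j) = 0 ∨ x.1 (hi j) = capExp m n L (hi j)) := fun h => h0 <| hιP <| by
        rw [hfP, hb, opU_mul_opL_mono_eq_zero hL (lo_ne_hi j).symm x.2 h, map_zero]
      push Not at h0'
      obtain ⟨y, c, d, hc, hd, hh, h1, -⟩ := move _ _ (lo_ne_hi j).symm x h0'.1 h0'.2
      rw [hlo, hhi] at hh
      exact ⟨y, c, by omega, hιP (by rw [hfP, h1, map_smul])⟩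
    · exact hιP (by rw [heP, hb, opU_mul_opL_mono_eq_zero hL (lo_ne_hi j) hγ (hg j), map_zero])
    · refine Subtype.ext (IsGreedy.unique hL.two_le (fun j => ?_) x.2 hg hγ)
      by_contra hcon
      push Not at hcon
      obtain ⟨y, c, d, hc, -, -, h1, -⟩ := move _ _ (lo_ne_hi j) x hcon.1 hcon.2
      rw [← heP, hx j, map_zero] at h1
      exact (smul_ne_zero hc fun h => b.ne_zero y (hιP (h.trans (map_zero _).symm))) h1.symm
  subst hv'
  exact isSimpleHighestWeight_of_isMonomial hD hχ hmono weight parity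

end operators

/-! ### Modules over algebras given by relations -/

section quotients

variable {k A : Type*} [Field k] [Ring A] [Algebra k A]

theorem mkAlgHom_eq_mkRingHom (r : A → A → Prop) (a : A) :
    (RingQuot.mkAlgHom k r a : RelQuot r) = RingQuot.mkRingHom r a := by
  rw [← RingQuot.mkAlgHom_coe k]
  rfl

theorem GenSystem.IsTriangular.quotient {J H : Type*} {D : GenSystem A J H} {hinv : H → A}
    (hD : D.IsTriangular k hinv) (r : A → A → Prop) :
    (D.map (RingQuot.mkRingHom r) : GenSystem (RelQuot r) J H).IsTriangular k
      (fun i => RingQuot.mkRingHom r (hinv i)) := by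
  have h := hD.map (B := RelQuot r) (RingQuot.mkAlgHom k r) (RingQuot.mkAlgHom_surjective k r)
  simp only [GenSystem.map, mkAlgHom_eq_mkRingHom] at h
  exact h

variable {W : Type*} [AddCommGroup W] [Module k W]
  [Module A W] [IsScalarTower k A W] (r : A → A → Prop)
  (h : ∀ x y, r x y → ∀ w : W, x • w = y • w)

theorem quotModule_mk_smul (a : A) (w : W) :
    letI := quotModule r h
    (RingQuot.mkRingHom r a : RelQuot r) • w = a • w :=
  DFunLike.congr_fun (RingQuot.lift_mkRingHom_apply (Module.toAddMonoidEnd A W)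
    (fun x y hxy => AddMonoidHom.ext (h x y hxy)) a) w

theorem quotModule_isScalarTower :
    letI := quotModule r h
    IsScalarTower k (RelQuot r) W := by
  let := quotModule r h
  refine ⟨fun c u w => ?_⟩
  obtain ⟨a, rfl⟩ := RingQuot.mkAlgHom_surjective k r u
  rw [← map_smul, mkAlgHom_eq_mkRingHom, mkAlgHom_eq_mkRingHom, quotModule_mk_smul,
    quotModule_mk_smul, smul_assoc]

end quotients

/-! ### The triangular structure of the quantum superalgebras -/

section triangular

variable {k : Type*} [Field k] {q : kˣ} {m n : ℕ}

theorem Uqgl_rel {x y : FreeAlgebra k (Gen m n)} (h : Rel q m n x y) :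
    RingQuot.mkAlgHom k (Rel q m n) x = RingQuot.mkAlgHom k (Rel q m n) y :=
  RingQuot.mkAlgHom_rel k h

theorem K_mul_Kinv (i : Fin (m + n)) : gen q m n (.K i) * gen q m n (.Kinv i) = 1 := by
  simpa [gen] using Uqgl_rel (Rel.KKinv (q := q) i)

theorem Kinv_mul_K (i : Fin (m + n)) : gen q m n (.Kinv i) * gen q m n (.K i) = 1 := by
  simpa [gen] using Uqgl_rel (Rel.KinvK (q := q) i)

theorem K_mul_F (i : Fin (m + n)) (j : Fin (m + n - 1)) :
    gen q m n (.K i) * gen q m n (.F j) =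
      ((qi q i ^ (-pairing m n i j) : kˣ) : k) • (gen q m n (.F j) * gen q m n (.K i)) := by
  simpa only [gen, calK, calKinv, map_mul, map_smul] using Uqgl_rel (Rel.KF (q := q) i j)

theorem Kinv_mul_F (i : Fin (m + n)) (j : Fin (m + n - 1)) :
    gen q m n (.Kinv i) * gen q m n (.F j) =
      (((qi q i ^ (-pairing m n i j))⁻¹ : kˣ) : k) • (gen q m n (.F j) * gen q m n (.Kinv i)) := by
  have h := congrArg (fun x => gen q m n (.Kinv i) * x * gen q m n (.Kinv i)) (K_mul_F (q := q) i j)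
  simp only [mul_smul_comm, smul_mul_assoc] at h
  rw [← mul_assoc, Kinv_mul_K, one_mul, mul_assoc, mul_assoc, K_mul_Kinv, mul_one] at h
  rw [h, smul_smul, Units.inv_mul, one_smul]

theorem sigma_mul_F (j : Fin (m + n - 1)) :
    gen q m n .sigma * gen q m n (.F j) =
      (-1 : k) ^ par j • (gen q m n (.F j) * gen q m n .sigma) := by
  have h2 : gen q m n .sigma * gen q m n .sigma = 1 := by
    simpa [gen] using Uqgl_rel (Rel.sigma_sq (q := q) (m := m) (n := n))
  have h : gen q m n .sigma * gen q m n (.F j) * gen q m n .sigma =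
      (-1 : k) ^ par j • gen q m n (.F j) := by
    simpa only [gen, calK, calKinv, map_mul, map_smul] using Uqgl_rel (Rel.sigmaF (q := q) j)
  rw [← smul_mul_assoc, ← h, mul_assoc, h2, mul_one]

theorem eq_add_of_sub_eq_smul_sub {R : Type*} [Ring R] [Algebra k R] {x y a b : R} {d : k}
    (h : x - y = d • (a - b)) : x = y + (d • a + -d • b) := by
  rw [neg_smul, ← sub_eq_add_neg, ← smul_sub, ← h, add_sub_cancel]

theorem E_mul_F (i j : Fin (m + n - 1)) : ∃ c d d' : k,
    gen q m n (.E i) * gen q m n (.F j) = c • (gen q m n (.F j) * gen q m n (.E i)) +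
      (d • calK q m n i + d' • calKinv q m n i) := by
  by_cases h : i = j
  · subst h
    refine ⟨(-1 : k) ^ (par i * par i), (((qi q (lo i) : kˣ) : k) - ((qi q (lo i) : kˣ) : k)⁻¹)⁻¹,
      -(((qi q (lo i) : kˣ) : k) - ((qi q (lo i) : kˣ) : k)⁻¹)⁻¹, ?_⟩
    refine eq_add_of_sub_eq_smul_sub (a := calK q m n i) (b := calKinv q m n i) ?_
    simpa only [gen, calK, calKinv, map_mul, map_smul, map_sub] using
      Uqgl_rel (Rel.EF (q := q) i)
  · refine ⟨(-1 : k) ^ (par i * par j), 0, 0, ?_⟩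
    rw [zero_smul, zero_smul, add_zero, add_zero, ← sub_eq_zero]
    simpa only [gen, map_mul, map_smul, map_sub, map_zero] using
      Uqgl_rel (Rel.EF_ne (q := q) i j h)

theorem K_mul_Kinv_mul_F (a b : Fin (m + n)) (j : Fin (m + n - 1)) : ∃ c : k,
    gen q m n (.K a) * gen q m n (.Kinv b) * gen q m n (.F j) =
      c • (gen q m n (.F j) * (gen q m n (.K a) * gen q m n (.Kinv b))) :=
  ⟨(((qi q b ^ (-pairing m n b j))⁻¹ : kˣ) : k) * ((qi q a ^ (-pairing m n a j) : kˣ) : k), by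
    rw [mul_assoc, Kinv_mul_F, mul_smul_comm, ← mul_assoc, K_mul_F, smul_mul_assoc, smul_smul,
      mul_assoc]⟩

theorem calKinv_mul_calK (j : Fin (m + n - 1)) : calKinv q m n j * calK q m n j = 1 := by
  rw [calKinv, calK, mul_assoc, ← mul_assoc (gen q m n (.Kinv (lo j))), Kinv_mul_K, one_mul,
    K_mul_Kinv]

variable (q m n)

theorem glSys_isTriangular : (glSys q m n).IsTriangular k (fun i => gen q m n (.Kinv i)) where
  adjoin_eq_top := by
    rw [eq_top_iff, ← (AlgHom.range_eq_top (RingQuot.mkAlgHom k (Rel q m n))).2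
      (RingQuot.mkAlgHom_surjective k (Rel q m n)), ← Algebra.map_top,
      ← FreeAlgebra.adjoin_range_ι, ← Algebra.adjoin_image]
    refine Algebra.adjoin_mono ?_
    rintro _ ⟨_, ⟨g, rfl⟩, rfl⟩
    cases g with
    | E j => exact Or.inl (Or.inl ⟨j, rfl⟩)
    | F j => exact Or.inl (Or.inr ⟨j, rfl⟩)
    | K i => exact Or.inr (Or.inl (Or.inl ⟨i, rfl⟩))
    | Kinv i => exact Or.inr (Or.inl (Or.inr ⟨i, rfl⟩))
    | sigma => exact Or.inr (Or.inr rfl)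
  hinv_mul := Kinv_mul_K
  toral_mul_f := by
    rintro _ ((⟨i, rfl⟩ | ⟨i, rfl⟩) | rfl) j
    · exact ⟨_, K_mul_F i j⟩
    · exact ⟨_, Kinv_mul_F i j⟩
    · exact ⟨_, sigma_mul_F j⟩
  e_mul_f i j := by
    obtain ⟨c, d, d', h⟩ := E_mul_F (q := q) i j
    have hK : ∀ i, gen q m n (.K i) ∈ Algebra.adjoin k
        ((glSys q m n).toral fun i => gen q m n (.Kinv i)) := fun i =>
      Algebra.subset_adjoin (Or.inl (Or.inl ⟨i, rfl⟩))
    have hKinv : ∀ i, gen q m n (.Kinv i) ∈ Algebra.adjoin k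
        ((glSys q m n).toral fun i => gen q m n (.Kinv i)) := fun i =>
      Algebra.subset_adjoin (Or.inl (Or.inr ⟨i, rfl⟩))
    exact ⟨c, _, Subalgebra.add_mem _
      (Subalgebra.smul_mem _ (Subalgebra.mul_mem _ (hK _) (hKinv _)) d)
      (Subalgebra.smul_mem _ (Subalgebra.mul_mem _ (hK _) (hKinv _)) d'), h⟩

/-- The inverses of the toral generators of `𝒰_q(sl(m|n))`. -/
def slInv (j : Fin (m + n - 1)) : Uqsl q m n := ⟨calKinv q m n j, Algebra.subset_adjoin (by simp)⟩

theorem slSys_adjoin : Algebra.adjoin k (Set.range (slSys q m n).e ∪ Set.range (slSys q m n).f ∪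
    (slSys q m n).toral (slInv q m n)) = ⊤ := by
  refine eq_top_iff.2 ((Algebra.adjoin_adjoin_coe_preimage (R := k)
    (s := Set.range (fun j => gen q m n (.E j)) ∪ Set.range (fun j => gen q m n (.F j)) ∪
      Set.range (calK q m n) ∪ Set.range (calKinv q m n) ∪ {gen q m n .sigma})).ge.trans
    (Algebra.adjoin_mono ?_))
  rintro x ((((⟨j, hj⟩ | ⟨j, hj⟩) | ⟨j, hj⟩) | ⟨j, hj⟩) | hx)
  · exact Or.inl (Or.inl ⟨j, Subtype.ext hj⟩)
  · exact Or.inl (Or.inr ⟨j, Subtype.ext hj⟩)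
  · exact Or.inr (Or.inl (Or.inl ⟨j, Subtype.ext hj⟩))
  · exact Or.inr (Or.inl (Or.inr ⟨j, Subtype.ext hj⟩))
  · exact Or.inr (Or.inr (Subtype.ext hx))

theorem slSys_toral_mul_f : ∀ x ∈ (slSys q m n).toral (slInv q m n), ∀ j, ∃ c : k,
    x * (slSys q m n).f j = c • ((slSys q m n).f j * x) := by
  rintro _ ((⟨i, rfl⟩ | ⟨i, rfl⟩) | rfl) j
  · obtain ⟨c, h⟩ := K_mul_Kinv_mul_F (q := q) (lo i) (hi i) j
    exact ⟨c, Subtype.ext h⟩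
  · obtain ⟨c, h⟩ := K_mul_Kinv_mul_F (q := q) (hi i) (lo i) j
    exact ⟨c, Subtype.ext h⟩
  · exact ⟨_, Subtype.ext (sigma_mul_F j)⟩

theorem slSys_e_mul_f (i j : Fin (m + n - 1)) : ∃ c : k,
    ∃ u ∈ Algebra.adjoin k ((slSys q m n).toral (slInv q m n)),
      (slSys q m n).e i * (slSys q m n).f j = c • ((slSys q m n).f j * (slSys q m n).e i) + u := by
  obtain ⟨c, d, d', h⟩ := E_mul_F (q := q) i j
  have h1 : (slSys q m n).h i ∈ Algebra.adjoin k ((slSys q m n).toral (slInv q m n)) :=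
    Algebra.subset_adjoin (Or.inl (Or.inl ⟨i, rfl⟩))
  have h2 : slInv q m n i ∈ Algebra.adjoin k ((slSys q m n).toral (slInv q m n)) :=
    Algebra.subset_adjoin (Or.inl (Or.inr ⟨i, rfl⟩))
  exact ⟨c, d • (slSys q m n).h i + d' • slInv q m n i,
    Subalgebra.add_mem _ (Subalgebra.smul_mem _ h1 d) (Subalgebra.smul_mem _ h2 d'),
    Subtype.ext h⟩

theorem slSys_isTriangular : (slSys q m n).IsTriangular k (slInv q m n) where
  adjoin_eq_top := slSys_adjoin q m n
  hinv_mul j := Subtype.ext (calKinv_mul_calK j)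
  toral_mul_f := slSys_toral_mul_f q m n
  e_mul_f := slSys_e_mul_f q m n

theorem glSysR_isTriangular : (glSysR q m n).IsTriangular k
    (fun i => RingQuot.mkRingHom (RestrictedRel (glSys q m n) (charQ q)) (gen q m n (.Kinv i))) :=
  (glSys_isTriangular q m n).quotient _

theorem slSysR_isTriangular : (slSysR q m n).IsTriangular k
    (fun i => RingQuot.mkRingHom (RestrictedRel (slSys q m n) (charQ q)) (slInv q m n i)) :=
  (slSys_isTriangular q m n).quotient _

end triangular

/-! ### The highest weights -/

section weights

variable {m n : ℕ}

theorem sum_eps {s : ℕ} (h1 : 1 ≤ s) (h2 : s ≤ m + n) : ∑ i, eps m n s i = 1 := by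
  rw [Finset.sum_eq_single (⟨s - 1, by omega⟩ : Fin (m + n))]
  · simp only [eps]
    rw [if_pos (by omega)]
  · intro i _ hi
    simp only [eps]
    rw [if_neg]
    intro h
    exact hi (Fin.ext (by simp only; omega))
  · intro h
    exact absurd (Finset.mem_univ _) h

theorem omegaWt_apply (r : ℕ) (i : Fin (m + n)) :
    omegaWt m n r i = if (i : ℕ) < r then 1 else 0 := by
  simp only [omegaWt, eps, Finset.sum_apply, Finset.sum_ite_eq, Finset.mem_Icc]
  exact if_congr (by omega) rfl rfl

theorem genWt_apply (t : ℕ) (i : Fin (m + n)) :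
    genWt m n t i = if (i : ℕ) < m then 1 else if (i : ℕ) = m then t - m else 0 := by
  simp only [genWt, Pi.add_apply, Pi.smul_apply, omegaWt_apply, eps, smul_eq_mul]
  split_ifs <;> omega

theorem resWt_apply (l : ℕ) {i : ℕ} (hi : 1 ≤ i) (r : ℕ) (x : Fin (m + n)) :
    resWt m n l i r x = if (x : ℕ) < m then 1 else if (x : ℕ) + 1 < m + i then l - 1 else
      if (x : ℕ) + 1 = m + i then r else 0 := by
  have h : (∑ p ∈ Finset.Ico 1 i, (l - 1) • eps m n (m + p)) x =
      if m ≤ (x : ℕ) ∧ (x : ℕ) + 1 < m + i then l - 1 else 0 := by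
    simp only [Finset.sum_apply, Pi.smul_apply, eps, smul_eq_mul, mul_ite, mul_one, mul_zero]
    by_cases hx : m ≤ (x : ℕ) ∧ (x : ℕ) + 1 < m + i
    · rw [if_pos hx, Finset.sum_eq_single_of_mem ((x : ℕ) + 1 - m)
        (Finset.mem_Ico.2 ⟨by omega, by omega⟩), if_pos (by omega)]
      intro p _ hp
      rw [if_neg (by omega)]
    · rw [if_neg hx]
      refine Finset.sum_eq_zero fun p hp => if_neg ?_
      rw [Finset.mem_Ico] at hp
      omega
  simp only [resWt, Pi.add_apply, Pi.smul_apply, omegaWt_apply, h, eps, smul_eq_mul]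
  split_ifs <;> omega

theorem omegaWt_sum {r : ℕ} (hr : r ≤ m + n) : ∑ i, omegaWt m n r i = r := by
  simp only [omegaWt, Finset.sum_apply]
  rw [Finset.sum_comm, Finset.sum_congr rfl fun s hs => sum_eps (Finset.mem_Icc.1 hs).1
    ((Finset.mem_Icc.1 hs).2.trans hr)]
  simp

theorem omegaWt_allowed {L t : ℕ} (hL : 2 ≤ L) (ht : t ≤ m) :
    Allowed L t (omegaWt m n t) where
  le_cap i := by
    have := capExp_pos hL i
    rw [omegaWt_apply]
    split_ifs <;> omega
  sum_eq := omegaWt_sum (by omega)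

theorem omegaWt_greedy {L t : ℕ} (ht : t ≤ m) : IsGreedy L (omegaWt m n t) := by
  intro j
  have hlo : (lo j : ℕ) = j := rfl
  have hhi : (hi j : ℕ) = j + 1 := rfl
  rw [omegaWt_apply, omegaWt_apply, capExp, hlo, hhi]
  split_ifs <;> omega

theorem genWt_allowed {t : ℕ} (ht : m < t) (hn : 0 < n) : Allowed (t + 2) t (genWt m n t) where
  le_cap i := by
    rw [genWt_apply, capExp]
    split_ifs <;> omega
  sum_eq := by
    simp only [genWt, Pi.add_apply, Pi.smul_apply, Finset.sum_add_distrib, ← Finset.smul_sum]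
    rw [omegaWt_sum (by omega), sum_eps (by omega) (by omega), smul_eq_mul]
    omega

theorem genWt_greedy (L t : ℕ) : IsGreedy L (genWt m n t) := by
  intro j
  have hlo : (lo j : ℕ) = j := rfl
  have hhi : (hi j : ℕ) = j + 1 := rfl
  rw [genWt_apply, genWt_apply, capExp, hlo, hhi]
  split_ifs <;> omega

theorem resWt_allowed {l t i r : ℕ} (ht : m < t) (hi : 1 ≤ i) (hin : i ≤ n) (hr : r ≤ l - 1)
    (h : t - m = (i - 1) * (l - 1) + r) : Allowed l t (resWt m n l i r) where
  le_cap x := by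
    rw [resWt_apply l hi, capExp]
    split_ifs <;> omega
  sum_eq := by
    have hs : ∑ x, (∑ p ∈ Finset.Ico 1 i, (l - 1) • eps m n (m + p)) x = (i - 1) * (l - 1) := by
      simp only [Finset.sum_apply, Pi.smul_apply]
      rw [Finset.sum_comm, Finset.sum_congr rfl fun p hp => by
        rw [← Finset.smul_sum, sum_eps (by have := Finset.mem_Ico.1 hp; omega)
          (by have := Finset.mem_Ico.1 hp; omega)]]
      simp
    simp only [resWt, Pi.add_apply, Pi.smul_apply, Finset.sum_add_distrib, hs]
    rw [← Finset.smul_sum]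
    rw [omegaWt_sum (by omega), sum_eps (by omega) (by omega), smul_eq_mul]
    omega

theorem resWt_greedy (l : ℕ) {i : ℕ} (hi : 1 ≤ i) (r : ℕ) : IsGreedy l (resWt m n l i r) := by
  intro j
  have hlo : (lo j : ℕ) = j := rfl
  have hhi : (QSuper.hi j : ℕ) = j + 1 := rfl
  rw [resWt_apply l hi, resWt_apply l hi, capExp, hlo, hhi]
  split_ifs <;> omega

end weights

/-! ### The homogeneous components -/

section components

variable {k : Type*} [Field k] {q : kˣ} {m n L t : ℕ}

theorem qnum_ne_zero_of_charQ_eq_zero (h : charQ q = 0) {r : ℕ} (hr : 0 < r) : qnum q r ≠ 0 := by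
  intro h0
  rcases Nat.sInf_eq_zero.1 h with h | h
  · exact absurd h.1 (lt_irrefl 0)
  · exact (Set.eq_empty_iff_forall_notMem.1 h r) ⟨hr, h0⟩

theorem qnum_ne_zero_of_lt_charQ {r : ℕ} (hr : 0 < r) (h : r < charQ q) : qnum q r ≠ 0 :=
  fun h0 => Nat.notMem_of_lt_sInf h ⟨hr, h0⟩

variable (q t) in
/-- In degree `t` the cutoff `t + 2` is no restriction at all; `t + 1` would be too small for the
bound `2 ≤ L` when `t = 0`. -/
theorem isCutoff_add_two : IsCutoff q (t + 2) t := ⟨by omega, Or.inr (by omega)⟩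

variable (q t) in
theorem isCutoff_charQ [hl : Fact (2 < charQ q)] : IsCutoff q (charQ q) t :=
  ⟨hl.out.le, Or.inl (qnum_charQ q hl.out)⟩

theorem Allowed.odd_lt [hl : Fact (2 < charQ q)] {β : Fin (m + n) → ℕ} (hβ : Allowed (charQ q) t β)
    (i : Fin (m + n)) (hi : m ≤ (i : ℕ)) : β i < charQ q := by
  have := hl.out
  have h := hβ.le_cap i
  rw [capExp, if_neg (not_lt.2 hi)] at h
  omega

theorem glChar_ne_zero (lam : Fin (m + n) → ℤ) (i : Fin (m + n)) : glChar q lam i ≠ 0 :=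
  Units.ne_zero _

theorem slChar_ne_zero (lam : Fin (m + n) → ℤ) (j : Fin (m + n - 1)) : slChar q lam j ≠ 0 :=
  Units.ne_zero _

variable [hq : Fact (q ^ 2 ≠ 1)]

theorem gen_smul (g : Gen m n) (w : Omega k m n) : gen q m n g • w = genAct q g w := by
  rw [smul_omega, act_gen]

theorem K_smul_mono (γ : Fin (m + n) → ℕ) (i : Fin (m + n)) :
    gen q m n (.K i) • mono k γ = glChar q (toWt γ) i • mono k γ := by
  rw [gen_smul, genAct, opSigma_mono, glChar, toWt, zpow_natCast, Units.val_pow_eq_pow_val]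

theorem calK_smul_mono (γ : Fin (m + n) → ℕ) (j : Fin (m + n - 1)) :
    calK q m n j • mono k γ = slChar q (toWt γ) j • mono k γ := by
  rw [calK, mul_smul, gen_smul (.Kinv _), genAct, opSigmaInv_mono, smul_comm, K_smul_mono,
    smul_smul, slChar, glChar, Units.val_mul, mul_comm]
  simp only [toWt, zpow_neg, zpow_natCast, ← inv_pow, Units.val_pow_eq_pow_val]

theorem sigma_smul_mono (γ : Fin (m + n) → ℕ) :
    gen q m n .sigma • mono k γ = parityChar k (toWt γ) • mono k γ := by
  have h : (∑ i : Fin (m + n), if (i : ℕ) < m then (0 : ℤ) else toWt γ i) =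
      ((∑ i : Fin (m + n), if (i : ℕ) < m then 0 else γ i : ℕ) : ℤ) := by
    push_cast
    rfl
  rw [gen_smul, genAct, opParity_mono, parityChar, h, zpow_natCast, Units.val_pow_eq_pow_val]
  simp

theorem gl_isSimpleHighestWeight (hL : IsCutoff q L t)
    (hne : ∀ r, 0 < r → r < L → qnum q r ≠ 0) {P : Submodule (Uqgl q m n) (Omega k m n)}
    (hP : (P : Set (Omega k m n)) = allowedSpan k m n L t) {γ : Fin (m + n) → ℕ}
    (hγ : Allowed L t γ) (hg : IsGreedy L γ) :
    IsSimpleHighestWeight (glSys q m n) (glChar q (toWt γ)) (parityChar k (toWt γ)) P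
      (mono k γ) :=
  isSimpleHighestWeight_of_greedy (glSys_isTriangular q m n) (glChar_ne_zero _)
    (ι := LinearMap.id) Function.injective_id (fun j w => gen_smul (.E j) w)
    (fun j w => gen_smul (.F j) w) (fun β _ => ⟨mono k β, rfl⟩) hL hne
    (fun w => by rw [← SetLike.mem_coe, hP]; rfl) rfl hγ hg (K_smul_mono γ) (sigma_smul_mono γ)

theorem sl_isSimpleHighestWeight (hL : IsCutoff q L t)
    (hne : ∀ r, 0 < r → r < L → qnum q r ≠ 0) {P : Submodule (Uqsl q m n) (Omega k m n)}
    (hP : (P : Set (Omega k m n)) = allowedSpan k m n L t) {γ : Fin (m + n) → ℕ}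
    (hγ : Allowed L t γ) (hg : IsGreedy L γ) :
    IsSimpleHighestWeight (slSys q m n) (slChar q (toWt γ)) (parityChar k (toWt γ)) P
      (mono k γ) :=
  isSimpleHighestWeight_of_greedy (slSys_isTriangular q m n) (slChar_ne_zero _)
    (ι := LinearMap.id) Function.injective_id (fun j w => gen_smul (.E j) w)
    (fun j w => gen_smul (.F j) w) (fun β _ => ⟨mono k β, rfl⟩) hL hne
    (fun w => by rw [← SetLike.mem_coe, hP]; rfl) rfl hγ hg (calK_smul_mono γ) (sigma_smul_mono γ)

/-- The span of the monomials of degree `t` below a cutoff is a submodule over `𝒰_q(gl(m|n))`. -/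
theorem exists_gl_submodule (m n : ℕ) (hL : IsCutoff q L t) :
    ∃ P : Submodule (Uqgl q m n) (Omega k m n),
      (P : Set (Omega k m n)) = allowedSpan k m n L t := by
  refine exists_submodule_of_stable (glSys_isTriangular q m n).adjoin_eq_top _ ?_
  have key : ∀ g, ∀ w ∈ allowedSpan k m n L t, gen q m n g • w ∈ allowedSpan k m n L t := by
    intro g w hw
    rw [gen_smul]
    exact genAct_allowedSpan hL g w hw
  rintro _ ((⟨j, rfl⟩ | ⟨j, rfl⟩) | ((⟨i, rfl⟩ | ⟨i, rfl⟩) | rfl))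
  · exact key (.E j)
  · exact key (.F j)
  · exact key (.K i)
  · exact key (.Kinv i)
  · exact key .sigma

/-- A `𝒰_q(gl(m|n))`-submodule, regarded over `𝒰_q(sl(m|n))`. -/
def toSl (P : Submodule (Uqgl q m n) (Omega k m n)) : Submodule (Uqsl q m n) (Omega k m n) where
  carrier := P
  add_mem' := P.add_mem
  zero_mem' := P.zero_mem
  smul_mem' u _ hw := P.smul_mem (u : Uqgl q m n) hw

section restricted

variable [hl : Fact (2 < charQ q)]

theorem mk_smul_gl (a : Uqgl q m n) (w : OmegaR q m n) :
    (RingQuot.mkRingHom (RestrictedRel (glSys q m n) (charQ q)) a : uqgl q m n) • w = a • w :=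
  quotModule_mk_smul _ (gl_restricted q) a w

theorem mk_smul_sl (a : Uqsl q m n) (w : OmegaR q m n) :
    (RingQuot.mkRingHom (RestrictedRel (slSys q m n) (charQ q)) a : uqsl q m n) • w = a • w :=
  quotModule_mk_smul _ (sl_restricted q) a w

instance : IsScalarTower k (uqgl q m n) (OmegaR q m n) :=
  quotModule_isScalarTower (k := k) (A := Uqgl q m n) _ (gl_restricted q)

instance : IsScalarTower k (uqsl q m n) (OmegaR q m n) :=
  quotModule_isScalarTower (k := k) (A := Uqsl q m n) _ (sl_restricted q)

/-- The part of a `𝒰_q(gl(m|n))`-submodule in `Ω_q^!(m|n, 𝟏)`, regarded over `u_q(gl(m|n))`. -/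
def toRestrictedGl (P : Submodule (Uqgl q m n) (Omega k m n)) :
    Submodule (uqgl q m n) (OmegaR q m n) where
  carrier := {w | (w : Omega k m n) ∈ P}
  add_mem' := P.add_mem
  zero_mem' := P.zero_mem
  smul_mem' u w hw := by
    obtain ⟨a, rfl⟩ := RingQuot.mkRingHom_surjective _ u
    rw [mk_smul_gl]
    exact P.smul_mem a hw

/-- The part of a `𝒰_q(gl(m|n))`-submodule in `Ω_q^!(m|n, 𝟏)`, regarded over `u_q(sl(m|n))`. -/
def toRestrictedSl (P : Submodule (Uqgl q m n) (Omega k m n)) :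
    Submodule (uqsl q m n) (OmegaR q m n) where
  carrier := {w | (w : Omega k m n) ∈ P}
  add_mem' := P.add_mem
  zero_mem' := P.zero_mem
  smul_mem' u w hw := by
    obtain ⟨a, rfl⟩ := RingQuot.mkRingHom_surjective _ u
    rw [mk_smul_sl]
    exact P.smul_mem (a : Uqgl q m n) hw

/-- The monomial with allowed exponent, as an element of `Ω_q^!(m|n, 𝟏)`. -/
def monoR {β : Fin (m + n) → ℕ} (hβ : Allowed (charQ q) t β) : OmegaR q m n :=
  ⟨mono k β, Submodule.subset_span ⟨β, hβ.odd_lt, rfl⟩⟩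

theorem mem_omegaRHom (w : OmegaR q m n) :
    w ∈ omegaRHom q m n t ↔ (w : Omega k m n) ∈ allowedSpan k m n (charQ q) t := by
  let f : OmegaR q m n →ₗ[k] Omega k m n := (OmegaR q m n).subtype.restrictScalars k
  constructor
  · intro hw
    refine (Submodule.span_le (p := (allowedSpan k m n (charQ q) t).comap f)).2 ?_ hw
    rintro x ⟨β, h1, h2, hx⟩
    change (x : Omega k m n) ∈ allowedSpan k m n (charQ q) t
    rw [hx]
    refine mono_ind (P := fun w => w ∈ (allowedSpan k m n (charQ q) t : Set (Omega k m n))) β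
      (Submodule.zero_mem _) fun h => mono_mem_allowedSpan ⟨fun i => ?_, h2⟩
    unfold capExp
    split_ifs with hi
    · exact h i hi
    · have := h1 i (not_lt.1 hi); omega
  · intro hw
    have hle : allowedSpan k m n (charQ q) t ≤ (omegaRHom q m n t).map f := by
      refine Submodule.span_le.2 ?_
      rintro _ ⟨β, hβ, rfl⟩
      exact ⟨monoR hβ, Submodule.subset_span ⟨β, hβ.odd_lt, hβ.sum_eq, rfl⟩, rfl⟩
    obtain ⟨w', hw', h⟩ := hle hw
    exact Subtype.ext h ▸ hw'

theorem glR_isSimpleHighestWeight {P : Submodule (uqgl q m n) (OmegaR q m n)}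
    (hP : (P : Set (OmegaR q m n)) = omegaRHom q m n t) {γ : Fin (m + n) → ℕ}
    (hγ : Allowed (charQ q) t γ) (hg : IsGreedy (charQ q) γ) :
    IsSimpleHighestWeight (glSysR q m n) (glChar q (toWt γ)) (parityChar k (toWt γ)) P
      (monoR hγ) :=
  isSimpleHighestWeight_of_greedy (glSysR_isTriangular q m n) (glChar_ne_zero _)
    (ι := (OmegaR q m n).subtype.restrictScalars k) Subtype.val_injective
    (fun j w => (congrArg Subtype.val (mk_smul_gl _ w)).trans (gen_smul (.E j) (w : Omega k m n)))
    (fun j w => (congrArg Subtype.val (mk_smul_gl _ w)).trans (gen_smul (.F j) (w : Omega k m n)))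
    (fun _ hβ => ⟨monoR hβ, rfl⟩) (isCutoff_charQ q t) (fun _ => qnum_ne_zero_of_lt_charQ)
    (fun w => by rw [← SetLike.mem_coe, hP]; exact mem_omegaRHom w) rfl hγ hg
    (fun i => (mk_smul_gl _ _).trans (Subtype.ext (K_smul_mono γ i)))
    ((mk_smul_gl _ _).trans (Subtype.ext (sigma_smul_mono γ)))

theorem slR_isSimpleHighestWeight {P : Submodule (uqsl q m n) (OmegaR q m n)}
    (hP : (P : Set (OmegaR q m n)) = omegaRHom q m n t) {γ : Fin (m + n) → ℕ}
    (hγ : Allowed (charQ q) t γ) (hg : IsGreedy (charQ q) γ) :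
    IsSimpleHighestWeight (slSysR q m n) (slChar q (toWt γ)) (parityChar k (toWt γ)) P
      (monoR hγ) :=
  isSimpleHighestWeight_of_greedy (slSysR_isTriangular q m n) (slChar_ne_zero _)
    (ι := (OmegaR q m n).subtype.restrictScalars k) Subtype.val_injective
    (fun j w => (congrArg Subtype.val (mk_smul_sl _ w)).trans (gen_smul (.E j) (w : Omega k m n)))
    (fun j w => (congrArg Subtype.val (mk_smul_sl _ w)).trans (gen_smul (.F j) (w : Omega k m n)))
    (fun _ hβ => ⟨monoR hβ, rfl⟩) (isCutoff_charQ q t) (fun _ => qnum_ne_zero_of_lt_charQ)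
    (fun w => by rw [← SetLike.mem_coe, hP]; exact mem_omegaRHom w) rfl hγ hg
    (fun i => (mk_smul_sl _ _).trans (Subtype.ext (calK_smul_mono γ i)))
    ((mk_smul_sl _ _).trans (Subtype.ext (sigma_smul_mono γ)))

end restricted

end components

end QSuper

end

theorem theorem33 {k : Type*} [Field k] [IsAlgClosed k] [CharZero k] (q : kˣ) [Fact (q ^ 2 ≠ 1)]
    (m n t : ℕ) :
    (∃ P : Submodule (QSuper.Uqgl q m n) (QSuper.Omega k m n),
      (P : Set (QSuper.Omega k m n)) = QSuper.omegaHom k m n t ∧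
      (QSuper.charQ q = 0 →
        (t ≤ m → QSuper.IsSimpleHighestWeight (QSuper.glSys q m n)
          (QSuper.glChar q (QSuper.toWt (QSuper.omegaWt m n t)))
          (QSuper.parityChar k (QSuper.toWt (QSuper.omegaWt m n t))) P
          (QSuper.mono k (QSuper.omegaWt m n t))) ∧
        (m < t → 0 < n → QSuper.IsSimpleHighestWeight (QSuper.glSys q m n)
          (QSuper.glChar q (QSuper.toWt (QSuper.genWt m n t)))
          (QSuper.parityChar k (QSuper.toWt (QSuper.genWt m n t))) P
          (QSuper.mono k (QSuper.genWt m n t))))) ∧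
    (∃ P : Submodule (QSuper.Uqsl q m n) (QSuper.Omega k m n),
      (P : Set (QSuper.Omega k m n)) = QSuper.omegaHom k m n t ∧
      (QSuper.charQ q = 0 →
        (t ≤ m → QSuper.IsSimpleHighestWeight (QSuper.slSys q m n)
          (QSuper.slChar q (QSuper.toWt (QSuper.omegaWt m n t)))
          (QSuper.parityChar k (QSuper.toWt (QSuper.omegaWt m n t))) P
          (QSuper.mono k (QSuper.omegaWt m n t))) ∧
        (m < t → 0 < n → QSuper.IsSimpleHighestWeight (QSuper.slSys q m n)
          (QSuper.slChar q (QSuper.toWt (QSuper.genWt m n t)))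
          (QSuper.parityChar k (QSuper.toWt (QSuper.genWt m n t))) P
          (QSuper.mono k (QSuper.genWt m n t))))) ∧
    (∀ [Fact (2 < QSuper.charQ q)],
      (∃ P : Submodule (QSuper.uqgl q m n) (QSuper.OmegaR q m n),
        (P : Set (QSuper.OmegaR q m n)) = QSuper.omegaRHom q m n t ∧
        (t ≤ m → ∃ v : QSuper.OmegaR q m n,
          (v : QSuper.Omega k m n) = QSuper.mono k (QSuper.omegaWt m n t) ∧
          QSuper.IsSimpleHighestWeight (QSuper.glSysR q m n)
            (QSuper.glChar q (QSuper.toWt (QSuper.omegaWt m n t)))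
            (QSuper.parityChar k (QSuper.toWt (QSuper.omegaWt m n t))) P v) ∧
        (m < t → ∀ i r : ℕ, 1 ≤ i → i ≤ n → r ≤ QSuper.charQ q - 1 →
          t - m = (i - 1) * (QSuper.charQ q - 1) + r → ∃ v : QSuper.OmegaR q m n,
          (v : QSuper.Omega k m n) = QSuper.mono k (QSuper.resWt m n (QSuper.charQ q) i r) ∧
          QSuper.IsSimpleHighestWeight (QSuper.glSysR q m n)
            (QSuper.glChar q (QSuper.toWt (QSuper.resWt m n (QSuper.charQ q) i r)))
            (QSuper.parityChar k (QSuper.toWt (QSuper.resWt m n (QSuper.charQ q) i r))) P v)) ∧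
      (∃ P : Submodule (QSuper.uqsl q m n) (QSuper.OmegaR q m n),
        (P : Set (QSuper.OmegaR q m n)) = QSuper.omegaRHom q m n t ∧
        (t ≤ m → ∃ v : QSuper.OmegaR q m n,
          (v : QSuper.Omega k m n) = QSuper.mono k (QSuper.omegaWt m n t) ∧
          QSuper.IsSimpleHighestWeight (QSuper.slSysR q m n)
            (QSuper.slChar q (QSuper.toWt (QSuper.omegaWt m n t)))
            (QSuper.parityChar k (QSuper.toWt (QSuper.omegaWt m n t))) P v) ∧
        (m < t → ∀ i r : ℕ, 1 ≤ i → i ≤ n → r ≤ QSuper.charQ q - 1 →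
          t - m = (i - 1) * (QSuper.charQ q - 1) + r → ∃ v : QSuper.OmegaR q m n,
          (v : QSuper.Omega k m n) = QSuper.mono k (QSuper.resWt m n (QSuper.charQ q) i r) ∧
          QSuper.IsSimpleHighestWeight (QSuper.slSysR q m n)
            (QSuper.slChar q (QSuper.toWt (QSuper.resWt m n (QSuper.charQ q) i r)))
            (QSuper.parityChar k (QSuper.toWt (QSuper.resWt m n (QSuper.charQ q) i r))) P v))) := by
  obtain ⟨P, hP⟩ := QSuper.exists_gl_submodule m n (QSuper.isCutoff_add_two q t)
  have hP' : (P : Set (QSuper.Omega k m n)) = QSuper.omegaHom k m n t := by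
    rw [hP, QSuper.omegaHom_eq_allowedSpan]
  refine ⟨⟨P, hP', fun h0 => ?_⟩, ⟨QSuper.toSl P, hP', fun h0 => ?_⟩, ?_⟩
  · have main := fun γ => QSuper.gl_isSimpleHighestWeight (γ := γ) (QSuper.isCutoff_add_two q t)
      (fun r hr _ => QSuper.qnum_ne_zero_of_charQ_eq_zero h0 hr) hP
    exact ⟨fun ht => main _ (QSuper.omegaWt_allowed (by omega) ht) (QSuper.omegaWt_greedy ht),
      fun ht hn => main _ (QSuper.genWt_allowed ht hn) (QSuper.genWt_greedy _ t)⟩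
  · have main := fun γ => QSuper.sl_isSimpleHighestWeight (γ := γ) (P := QSuper.toSl P)
      (QSuper.isCutoff_add_two q t)
      (fun r hr _ => QSuper.qnum_ne_zero_of_charQ_eq_zero h0 hr) hP
    exact ⟨fun ht => main _ (QSuper.omegaWt_allowed (by omega) ht) (QSuper.omegaWt_greedy ht),
      fun ht hn => main _ (QSuper.genWt_allowed ht hn) (QSuper.genWt_greedy _ t)⟩
  · intro hl
    obtain ⟨R, hR⟩ := QSuper.exists_gl_submodule m n (QSuper.isCutoff_charQ q t)
    have hmem : ∀ w : QSuper.OmegaR q m n,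
        (w : QSuper.Omega k m n) ∈ R ↔ w ∈ QSuper.omegaRHom q m n t := fun w => by
      rw [QSuper.mem_omegaRHom, ← SetLike.mem_coe, hR]
      rfl
    have hgl : (QSuper.toRestrictedGl R : Set (QSuper.OmegaR q m n)) =
        QSuper.omegaRHom q m n t := Set.ext hmem
    have hsl : (QSuper.toRestrictedSl R : Set (QSuper.OmegaR q m n)) =
        QSuper.omegaRHom q m n t := Set.ext hmem
    exact ⟨⟨_, hgl,
      fun ht => ⟨_, rfl, QSuper.glR_isSimpleHighestWeight hgl
        (QSuper.omegaWt_allowed hl.out.le ht) (QSuper.omegaWt_greedy ht)⟩,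
      fun ht i r hi hin hr h => ⟨_, rfl, QSuper.glR_isSimpleHighestWeight hgl
        (QSuper.resWt_allowed ht hi hin hr h) (QSuper.resWt_greedy _ hi r)⟩⟩,
      ⟨_, hsl,
      fun ht => ⟨_, rfl, QSuper.slR_isSimpleHighestWeight hsl
        (QSuper.omegaWt_allowed hl.out.le ht) (QSuper.omegaWt_greedy ht)⟩,
      fun ht i r hi hin hr h => ⟨_, rfl, QSuper.slR_isSimpleHighestWeight hsl
        (QSuper.resWt_allowed ht hi hin hr h) (QSuper.resWt_greedy _ hi r)⟩⟩⟩
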